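/- Let $n\in\mathbb N$ and let $\mathcal M\subseteq M_n=M_n(\mathbb C)$ be a von Neumann algebra (a unital $*$-subalgebra with $\mathcal M''=\mathcal M$). Let $(\mathcal M')^\perp\subseteq M_n$ be the orthogonal complement of the commutant $\mathcal M'$ with respect to $\langle Y,X\rangle=\operatorname{Tr}(Y^*X)$. The complete quantum graph of $\mathcal M$ is $\mathcal G=(M_n\cap(\mathcal M')^\perp,\mathcal M,M_n)$. For $b,c\in\mathbb N$, a *$b$-fold coloring of $\mathcal G$ using $c$ colors* over a von Neumann algebra $\mathcal N$ consists of projections $P_1,\dots,P_c\in\mathcal M\bar\otimes\mathcal N$ such that (1) $P_{a_1}P_{a_2}=P_{a_2}P_{a_1}$ for all $a_1,a_2$; (2) $\sum_{T\subseteq\{1,\dots,c\},\,|T|=b}\ \prod_{a\in T}P_a=I_{\mathcal M\bar\otimes\mathcal N}$; (3) $P_a(X\otimes I_{\mathcal N})P_a=0$ for all $a$ and all $X\in M_n\cap(\mathcal M')^\perp$. Here $\mathcal N$ acts on a separable Hilbert space and carries a faithful normal tracial state $\tau$. The coloring is of type $q$ if moreover $\dim\mathcal N<\infty$; of type $qa$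 if moreover $(\mathcal N,\tau)$ admits an injective trace-preserving $*$-homomorphism into an ultrapower $\mathcal R^\omega$ of the hyperfinite II$_1$ factor $\mathcal R$ for some free ultrafilter $\omega$ on $\mathbb N$; and of type $qc$ with no further condition. For $t\in\{q,qa,qc\}$ let $\chi_{b,t}(\mathcal G)$ be the least $c$ such that $\mathcal G$ has a $b$-fold coloring of type $t$ using $c$ colors, or $\infty$ if there is none. Then, for every $b\in\mathbb N$ and every $t\in\{q,qa,qc\}$, $$\chi_{b,t}(\mathcal G)=b\cdot\dim\mathcal M .$$ -/

import Mathlib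

open Filter Topology
open scoped ComplexOrder InnerProductSpace

noncomputable section

namespace QGraph

/-! ### Finite von Neumann algebras -/

section VN

variable {H : Type*} [NormedAddCommGroup H] [InnerProductSpace ℂ H] [CompleteSpace H]

/-- `τ` is a faithful normal tracial state on the von Neumann algebra `N ⊆ B(H)`.
Normality is ultraweak continuity, that is, `τ` is a sum of vector functionals
`x ↦ ∑ₖ ⟪ξₖ, x ηₖ⟫` with `∑ ‖ξₖ‖² < ∞` and `∑ ‖ηₖ‖² < ∞`. -/
structure IsFaithfulNormalTracialState (N : VonNeumannAlgebra H)
    (τ : N.toStarSubalgebra →ₗ[ℂ] ℂ) : Prop where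
  map_one : τ 1 = 1
  nonneg : ∀ x : N.toStarSubalgebra, 0 ≤ (x : H →L[ℂ] H) → 0 ≤ τ x
  tracial : ∀ x y : N.toStarSubalgebra, τ (x * y) = τ (y * x)
  faithful : ∀ x : N.toStarSubalgebra, τ (star x * x) = 0 → x = 0
  normal : ∃ ξ η : ℕ → H, Summable (fun k => ‖ξ k‖ ^ 2) ∧ Summable (fun k => ‖η k‖ ^ 2) ∧
    ∀ x : N.toStarSubalgebra, HasSum (fun k => ⟪ξ k, (x : H →L[ℂ] H) (η k)⟫_ℂ) (τ x)

/-- `R`, with its trace `σ`, is a hyperfinite II₁ factor: a factor which is infinite dimensional,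
carries a faithful normal tracial state, and is generated as a von Neumann algebra by an
increasing sequence of finite dimensional unital `*`-subalgebras.
(By Murray and von Neumann it is unique up to a trace preserving isomorphism.) -/
structure IsHyperfiniteIIOneFactor (R : VonNeumannAlgebra H)
    (σ : R.toStarSubalgebra →ₗ[ℂ] ℂ) : Prop where
  trace : IsFaithfulNormalTracialState R σ
  factor : ∀ x ∈ R, x ∈ R.commutant → ∃ z : ℂ, x = z • (1 : H →L[ℂ] H)
  infinite : ¬ FiniteDimensional ℂ R.toStarSubalgebra
  hyperfinite : ∃ A : ℕ → StarSubalgebra ℂ (H →L[ℂ] H), Monotone A ∧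
    (∀ k, FiniteDimensional ℂ (A k)) ∧
    Set.centralizer (Set.centralizer (⋃ k, (A k : Set (H →L[ℂ] H)))) = R

/-! ### Tracial ultrapowers -/

/-- The `*`-algebra `ℓ^∞(ℕ, R)` of norm bounded sequences in `R`. -/
def boundedSeq (R : VonNeumannAlgebra H) : StarSubalgebra ℂ (ℕ → R.toStarSubalgebra) where
  carrier := {x | ∃ C : ℝ, ∀ k, ‖(x k : H →L[ℂ] H)‖ ≤ C}
  mul_mem' := by
    rintro x y ⟨C, hC⟩ ⟨D, hD⟩
    exact ⟨C * D, fun k => (norm_mul_le _ _).trans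
      (mul_le_mul (hC k) (hD k) (norm_nonneg _) ((norm_nonneg _).trans (hC k)))⟩
  add_mem' := by
    rintro x y ⟨C, hC⟩ ⟨D, hD⟩
    exact ⟨C + D, fun k => (norm_add_le _ _).trans (add_le_add (hC k) (hD k))⟩
  algebraMap_mem' := by
    intro z
    exact ⟨‖algebraMap ℂ (H →L[ℂ] H) z‖, fun k => le_rfl⟩
  star_mem' := by
    rintro x ⟨C, hC⟩
    exact ⟨C, fun k => by simpa using hC k⟩

variable {R : VonNeumannAlgebra H} {σ : R.toStarSubalgebra →ₗ[ℂ] ℂ}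

theorem IsFaithfulNormalTracialState.star_mul_self_nonneg
    (h : IsFaithfulNormalTracialState R σ) (x : R.toStarSubalgebra) : 0 ≤ σ (star x * x) :=
  h.nonneg _ (_root_.star_mul_self_nonneg (x : H →L[ℂ] H))

theorem IsFaithfulNormalTracialState.mono (h : IsFaithfulNormalTracialState R σ)
    {x y : R.toStarSubalgebra} (hxy : (x : H →L[ℂ] H) ≤ y) : σ x ≤ σ y := by
  have := h.nonneg (y - x) (by simpa using hxy)
  rw [map_sub] at this
  exact sub_nonneg.1 this

theorem IsFaithfulNormalTracialState.mul_left_le (h : IsFaithfulNormalTracialState R σ)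
    (a x : R.toStarSubalgebra) {C : ℝ} (hC : ‖(a : H →L[ℂ] H)‖ ≤ C) :
    σ (star (a * x) * (a * x)) ≤ ((C ^ 2 : ℝ) : ℂ) * σ (star x * x) := by
  have h1 : σ (star (a * x) * (a * x)) ≤ σ (((‖(a : H →L[ℂ] H)‖ ^ 2 : ℝ) : ℂ) • (star x * x)) := by
    apply h.mono
    have := CStarAlgebra.star_left_conjugate_le_norm_smul (a := (x : H →L[ℂ] H))
      (b := star (a : H →L[ℂ] H) * a) (IsSelfAdjoint.star_mul_self _)
    rw [CStarRing.norm_star_mul_self, ← pow_two] at this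
    have e : ((‖(a : H →L[ℂ] H)‖ ^ 2 : ℝ) : ℂ) • (star (x : H →L[ℂ] H) * (x : H →L[ℂ] H))
        = (‖(a : H →L[ℂ] H)‖ ^ 2 : ℝ) • (star (x : H →L[ℂ] H) * (x : H →L[ℂ] H)) :=
      Complex.coe_smul _ _
    change star ((a : H →L[ℂ] H) * x) * ((a : H →L[ℂ] H) * x) ≤
      ((‖(a : H →L[ℂ] H)‖ ^ 2 : ℝ) : ℂ) • (star (x : H →L[ℂ] H) * (x : H →L[ℂ] H))
    rw [e, star_mul]
    simpa only [mul_assoc] using this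
  refine h1.trans ?_
  rw [map_smul, smul_eq_mul]
  refine mul_le_mul_of_nonneg_right ?_ (h.star_mul_self_nonneg x)
  exact_mod_cast pow_le_pow_left₀ (norm_nonneg _) hC 2

theorem tendsto_zero_of_le {ω : Filter ℕ} {f g : ℕ → ℂ} (h0 : ∀ k, 0 ≤ f k)
    (hfg : ∀ k, f k ≤ g k) (hg : Tendsto g ω (𝓝 0)) : Tendsto f ω (𝓝 0) := by
  refine squeeze_zero_norm (a := fun k => ‖g k‖) (fun k => ?_) (by simpa using hg.norm)
  exact CStarAlgebra.norm_le_norm_of_nonneg_of_le (h0 k) (hfg k)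

/-- Squared `2`-norm convergence to `0` along `ω`. -/
def IsNull (σ : R.toStarSubalgebra →ₗ[ℂ] ℂ) (ω : Ultrafilter ℕ) (x : ℕ → R.toStarSubalgebra) :
    Prop :=
  Tendsto (fun k => σ (star (x k) * x k)) ω (𝓝 0)

theorem IsNull.add (h : IsFaithfulNormalTracialState R σ) {ω : Ultrafilter ℕ}
    {x y : ℕ → R.toStarSubalgebra} (hx : IsNull σ ω x) (hy : IsNull σ ω y) :
    IsNull σ ω (x + y) := by
  refine tendsto_zero_of_le (fun k => h.star_mul_self_nonneg _)
    (g := fun k => 2 * σ (star (x k) * x k) + 2 * σ (star (y k) * y k)) (fun k => ?_)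
    (by simpa using (Tendsto.const_mul 2 hx).add (Tendsto.const_mul 2 hy))
  have e : 2 * σ (star (x k) * x k) + 2 * σ (star (y k) * y k)
      - σ (star (x k + y k) * (x k + y k))
      = σ (star (x k - y k) * (x k - y k)) := by
    simp only [star_add, star_sub, add_mul, mul_add, sub_mul, mul_sub, map_add, map_sub]
    ring
  have := h.star_mul_self_nonneg (x k - y k)
  rw [← e] at this
  exact sub_nonneg.1 this

theorem IsNull.mul_left (h : IsFaithfulNormalTracialState R σ) {ω : Ultrafilter ℕ}
    {a x : ℕ → R.toStarSubalgebra} {C : ℝ} (hC : ∀ k, ‖(a k : H →L[ℂ] H)‖ ≤ C)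
    (hx : IsNull σ ω x) : IsNull σ ω (a * x) := by
  have := Tendsto.const_mul ((C ^ 2 : ℝ) : ℂ) hx
  rw [mul_zero] at this
  exact tendsto_zero_of_le (fun k => h.star_mul_self_nonneg _)
    (fun k => h.mul_left_le (a k) (x k) (hC k)) this

theorem IsNull.star (h : IsFaithfulNormalTracialState R σ) {ω : Ultrafilter ℕ}
    {x : ℕ → R.toStarSubalgebra} (hx : IsNull σ ω x) : IsNull σ ω (star x) := by
  refine Tendsto.congr (fun k => ?_) hx
  rw [Pi.star_apply, star_star, h.tracial]

theorem IsNull.mul_right (h : IsFaithfulNormalTracialState R σ) {ω : Ultrafilter ℕ}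
    {a x : ℕ → R.toStarSubalgebra} {C : ℝ} (hC : ∀ k, ‖(a k : H →L[ℂ] H)‖ ≤ C)
    (hx : IsNull σ ω x) : IsNull σ ω (x * a) := by
  have h1 := IsNull.mul_left h (a := Star.star a) (C := C)
    (fun k => (norm_star (a k : H →L[ℂ] H)).trans_le (hC k)) (IsNull.star h hx)
  have h2 := IsNull.star h h1
  rwa [star_mul, star_star, star_star] at h2

/-- The two-sided ideal of bounded sequences `x` with `lim_ω σ(xₖ* xₖ) = 0`. -/
def nullIdeal (h : IsFaithfulNormalTracialState R σ) (ω : Ultrafilter ℕ) :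
    TwoSidedIdeal (boundedSeq R) :=
  TwoSidedIdeal.mk' {x | IsNull σ ω x.1}
    (by
      change Tendsto (fun _ => σ (Star.star (0 : R.toStarSubalgebra) * 0)) (ω : Filter ℕ) (𝓝 0)
      rw [mul_zero, map_zero]
      exact tendsto_const_nhds)
    (fun {_ _} hx hy => IsNull.add h hx hy)
    (by
      intro x hx
      refine Tendsto.congr (fun k => ?_) hx
      change _ = σ (Star.star (-x.1 k) * (-x.1 k))
      rw [star_neg, neg_mul_neg])
    (fun {a _} hx => IsNull.mul_left h a.2.choose_spec hx)
    (fun {_ a} hx => IsNull.mul_right h a.2.choose_spec hx)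

theorem mem_nullIdeal (h : IsFaithfulNormalTracialState R σ) (ω : Ultrafilter ℕ)
    (x : boundedSeq R) :
    x ∈ nullIdeal h ω ↔ IsNull σ ω x.1 :=
  TwoSidedIdeal.mem_mk' ..

/-- The tracial ultrapower `R^ω = ℓ^∞(ℕ, R) / {x | lim_ω σ(xₖ* xₖ) = 0}`. -/
abbrev Ultrapower (h : IsFaithfulNormalTracialState R σ) (ω : Ultrafilter ℕ) : Type _ :=
  (nullIdeal h ω).ringCon.Quotient

/-- The class in `R^ω` of a bounded sequence. -/
def Ultrapower.mk (h : IsFaithfulNormalTracialState R σ) (ω : Ultrafilter ℕ)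
    (x : boundedSeq R) : Ultrapower h ω :=
  (x : (nullIdeal h ω).ringCon.Quotient)

/-- The adjoint on `R^ω`, computed on representing sequences. -/
instance (h : IsFaithfulNormalTracialState R σ) (ω : Ultrafilter ℕ) :
    Star (Ultrapower h ω) where
  star := Quotient.map' star (by
    intro x y hxy
    have hxy' := (TwoSidedIdeal.rel_iff (nullIdeal h ω) x y).1 hxy
    refine (TwoSidedIdeal.rel_iff (nullIdeal h ω) (star x) (star y)).2 ?_
    rw [mem_nullIdeal] at hxy' ⊢
    have h1 := IsNull.star h hxy'
    change IsNull σ ω (star (x.1 - y.1)) at h1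
    rwa [star_sub] at h1)

theorem Ultrapower.star_mk (h : IsFaithfulNormalTracialState R σ) (ω : Ultrafilter ℕ)
    (x : boundedSeq R) : star (Ultrapower.mk h ω x) = Ultrapower.mk h ω (star x) := rfl

end VN

/-- The finite von Neumann algebra `(N, τ)` embeds into `R^ω`: for a hyperfinite II₁ factor `R`
and a free ultrafilter `ω` on `ℕ` there is an injective trace preserving `*`-homomorphism
from `N` to the ultrapower `R^ω`, whose trace is `[y] ↦ lim_ω σ(yₖ)`. -/
def EmbedsInUltrapower {H : Type*} [NormedAddCommGroup H] [InnerProductSpace ℂ H]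
    [CompleteSpace H] (N : VonNeumannAlgebra H) (τ : N.toStarSubalgebra →ₗ[ℂ] ℂ) : Prop :=
  ∃ (K : Type) (_ : NormedAddCommGroup K) (_ : InnerProductSpace ℂ K) (_ : CompleteSpace K)
    (R : VonNeumannAlgebra K) (σ : R.toStarSubalgebra →ₗ[ℂ] ℂ)
    (hR : IsHyperfiniteIIOneFactor R σ) (ω : Ultrafilter ℕ) (_ : (ω : Filter ℕ) ≤ cofinite)
    (φ : N.toStarSubalgebra →⋆ₐ[ℂ] Ultrapower hR.trace ω),
    Function.Injective φ ∧
    ∀ (x : N.toStarSubalgebra) (y : boundedSeq R), Ultrapower.mk hR.trace ω y = φ x →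
      Tendsto (fun k => σ (y.1 k)) ω (𝓝 (τ x))

/-! ### Quantum graphs on `M_n` -/

/-- The orthogonal complement of `T ⊆ M_n` for the inner product `Tr(Y* X)`. -/
def tracePerp {n : ℕ} (T : Set (Matrix (Fin n) (Fin n) ℂ)) :
    Submodule ℂ (Matrix (Fin n) (Fin n) ℂ) where
  carrier := {X | ∀ Y ∈ T, (star Y * X).trace = 0}
  add_mem' := by
    intro a b ha hb Y hY
    rw [mul_add, Matrix.trace_add, ha Y hY, hb Y hY, add_zero]
  zero_mem' := by simp
  smul_mem' := by
    intro c a ha Y hY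
    rw [mul_smul_comm, Matrix.trace_smul, ha Y hY, smul_zero]

/-- An (irreflexive) quantum graph `(S, M, M_n)`: `M ⊆ M_n` is a von Neumann algebra (a unital
`*`-subalgebra equal to its bicommutant), and `S ⊆ M_n` is a self-adjoint subspace that is a
bimodule over the commutant `M'` and is orthogonal to `M'`. -/
structure QuantumGraph (n : ℕ) where
  S : Submodule ℂ (Matrix (Fin n) (Fin n) ℂ)
  M : StarSubalgebra ℂ (Matrix (Fin n) (Fin n) ℂ)
  bicommutant : Set.centralizer (Set.centralizer (M : Set (Matrix (Fin n) (Fin n) ℂ))) = M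
  star_mem : ∀ X ∈ S, star X ∈ S
  bimodule : ∀ A ∈ Set.centralizer (M : Set (Matrix (Fin n) (Fin n) ℂ)), ∀ X ∈ S,
    ∀ B ∈ Set.centralizer (M : Set (Matrix (Fin n) (Fin n) ℂ)), A * X * B ∈ S
  le_perp : S ≤ tracePerp (Set.centralizer (M : Set (Matrix (Fin n) (Fin n) ℂ)))

/-- The complete quantum graph `(M_n ∩ (M')^⊥, M, M_n)`. -/
def completeQuantumGraph {n : ℕ} (M : StarSubalgebra ℂ (Matrix (Fin n) (Fin n) ℂ))
    (hM : Set.centralizer (Set.centralizer (M : Set (Matrix (Fin n) (Fin n) ℂ))) = M) :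
    QuantumGraph n where
  S := tracePerp (Set.centralizer (M : Set (Matrix (Fin n) (Fin n) ℂ)))
  M := M
  bicommutant := hM
  star_mem := by
    intro X hX Y hY
    have h1 : star Y ∈ Set.centralizer (M : Set (Matrix (Fin n) (Fin n) ℂ)) :=
      Set.star_mem_centralizer' (fun a ha => star_mem ha) hY
    have h2 := hX _ h1
    rw [star_star, Matrix.trace_mul_comm] at h2
    have h3 := congrArg star h2
    rwa [← Matrix.trace_conjTranspose, ← Matrix.star_eq_conjTranspose, star_mul, star_zero] at h3
  bimodule := by
    intro A hA X hX B hB Y hY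
    have hs : ∀ C ∈ Set.centralizer (M : Set (Matrix (Fin n) (Fin n) ℂ)),
        star C ∈ Set.centralizer (M : Set (Matrix (Fin n) (Fin n) ℂ)) :=
      fun C hC => Set.star_mem_centralizer' (fun a ha => star_mem ha) hC
    have h1 := hX (star A * Y * star B)
      (Set.mul_mem_centralizer (Set.mul_mem_centralizer (hs A hA) hY) (hs B hB))
    rw [star_mul, star_mul, star_star, star_star] at h1
    rw [← mul_assoc, Matrix.trace_mul_comm, ← h1]
    simp only [mul_assoc]
  le_perp := le_rfl

/-! ### Colorings

Operators on `ℂⁿ ⊗ H` are written as `n × n` block matrices over `B(H)`. -/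

section Tensor

variable {n : ℕ} {H : Type*} [NormedAddCommGroup H] [InnerProductSpace ℂ H] [CompleteSpace H]

/-- The elementary tensor `x ⊗ y` of `x ∈ M_n` and `y ∈ B(H)`, in `B(ℂⁿ ⊗ H) = M_n(B(H))`. -/
def tmul (x : Matrix (Fin n) (Fin n) ℂ) (y : H →L[ℂ] H) : Matrix (Fin n) (Fin n) (H →L[ℂ] H) :=
  Matrix.of fun i j => x i j • y

/-- The von Neumann tensor product `M ⊗̄ N ⊆ B(ℂⁿ ⊗ H)`, the bicommutant of the set of elementary
tensors `x ⊗ y` with `x ∈ M` and `y ∈ N`. -/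
def vnTensor (M : StarSubalgebra ℂ (Matrix (Fin n) (Fin n) ℂ)) (N : VonNeumannAlgebra H) :
    Set (Matrix (Fin n) (Fin n) (H →L[ℂ] H)) :=
  Set.centralizer (Set.centralizer {p | ∃ x ∈ M, ∃ y ∈ N, p = tmul x y})

/-- The projections `P_a ∈ M ⊗̄ N`, for `a` among `c` colors, form a `b`-fold coloring of `G`. -/
def IsBFoldColoring (G : QuantumGraph n) (N : VonNeumannAlgebra H) (b : ℕ) {c : ℕ}
    (P : Fin c → Matrix (Fin n) (Fin n) (H →L[ℂ] H)) : Prop :=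
  (∀ a, P a ∈ vnTensor G.M N) ∧
  (∀ a, IsStarProjection (P a)) ∧
  (∃ comm : ∀ a₁ a₂, Commute (P a₁) (P a₂),
    ∑ T ∈ (Finset.univ : Finset (Fin c)).powersetCard b,
      T.noncommProd P (fun a₁ _ a₂ _ _ => comm a₁ a₂) = 1) ∧
  (∀ a, ∀ X ∈ G.S, P a * tmul X (1 : H →L[ℂ] H) * P a = 0)

end Tensor

/-- The four types of colorings: local, quantum, quantum approximate, quantum commuting. -/
inductive ColoringType
  | loc
  | q
  | qa
  | qc

/-- The condition that each type puts on the finite von Neumann algebra `N` with trace `τ`. -/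
def ColoringType.Admits {H : Type*} [NormedAddCommGroup H] [InnerProductSpace ℂ H]
    [CompleteSpace H] (t : ColoringType) (N : VonNeumannAlgebra H)
    (τ : N.toStarSubalgebra →ₗ[ℂ] ℂ) : Prop :=
  match t with
  | .loc => Module.finrank ℂ N.toStarSubalgebra = 1
  | .q => FiniteDimensional ℂ N.toStarSubalgebra
  | .qa => EmbedsInUltrapower N τ
  | .qc => True

/-- `G` admits a `t`-`b`-fold coloring using `c` colors. The auxiliary algebra `N` is a finite
von Neumann algebra on a separable Hilbert space, with a faithful normal tracial state `τ`. -/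
def HasBFoldColoring {n : ℕ} (G : QuantumGraph n) (t : ColoringType) (b c : ℕ) : Prop :=
  ∃ (H : Type) (_ : NormedAddCommGroup H) (_ : InnerProductSpace ℂ H) (_ : CompleteSpace H)
    (_ : TopologicalSpace.SeparableSpace H)
    (N : VonNeumannAlgebra H) (τ : N.toStarSubalgebra →ₗ[ℂ] ℂ),
    IsFaithfulNormalTracialState N τ ∧ t.Admits N τ ∧
    ∃ P : Fin c → Matrix (Fin n) (Fin n) (H →L[ℂ] H), IsBFoldColoring G N b P

/-- The `t`-`b`-fold chromatic number: the least number of colors, or `∞` if there is none. -/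
def bFoldChromaticNumber {n : ℕ} (G : QuantumGraph n) (t : ColoringType) (b : ℕ) : ℕ∞ :=
  sInf {m : ℕ∞ | ∃ c : ℕ, m = c ∧ HasBFoldColoring G t b c}

end QGraph

end

noncomputable section

namespace QGraph

/-! ### Commuting idempotents -/

section Idempotents

variable {ι : Type*} [DecidableEq ι]

/-! The algebra `M` is a direct sum of full matrix blocks of sizes `d k`, realised by matrix units
(`exists_matrixUnits`), so `dim M = ∑ d k ^ 2`. Both bounds are read off from this decomposition.

Lower bound. For commuting projections and `b ≠ 0`, condition (2) says that at every point of the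
joint spectrum exactly `b` of them equal one, so they add up to `b`
(`sum_eq_of_sum_noncommProd_eq_one`). Let `E` be the conditional expectation onto `M'`. Since `P`
commutes with `M' ⊗ 1`, condition (3) becomes `P (X ⊗ 1) P = (E X ⊗ 1) P` for every `X`. Give a
minimal projection of block `k` the weight `d k`; the density `D` of this trace has `Tr D = dim M`.
With exactly this weight, the slice `(Tr(D ·) ⊗ id)(P)` is again a projection, now in `B(H)`
(`slice_mul_slice`). The `c` slices have norm at most one and their sum is `b * dim M` times the
identity, hence `b * dim M ≤ c`. The trace `τ` serves only to know that `H ≠ 0`, so the bound is the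
same for all types.

Upper bound. In each block take the Weyl unitaries, indexed by `(ℤ/d)²`, and tensor them with
unitaries of `N` that obey the conjugate commutation relations. The phases cancel, which leaves a
true representation of a finite abelian group. Its `d ^ 2` spectral projections, over all blocks,
form a partition of unity with `dim M` members. Conjugating `X` by the group and summing gives a
multiple of the block part of `E X`, while each spectral projection absorbs the group elements up to
phases; so compressing `X ⊥ M'` by it gives zero (`charProj_mul_tmul_mul_charProj`). Using each
projection for `b` colors gives the coloring (`exists_isBFoldColoring`).

The auxiliary `N` is the twisted group von Neumann algebra of a direct sum of groups `(ℤ/m)²`: a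
finite sum for types `q` and `qc`; for `qa` the sum over all `m ≥ 1`, which is a hyperfinite II₁
factor and sits in its own ultrapower as constant sequences. -/

theorem prod_mul_prod_of_subset {R : Type*} [CommRing R] {p : ι → R}
    (hp : ∀ a, p a * p a = p a) {s t : Finset ι} (hst : s ⊆ t) :
    (∏ a ∈ s, p a) * ∏ a ∈ t, p a = ∏ a ∈ t, p a := by
  rw [← Finset.prod_sdiff hst, mul_left_comm, ← Finset.prod_mul_distrib]
  simp only [hp]

theorem prod_mul_prod_eq_prod_union {R : Type*} [CommRing R] {p : ι → R}
    (hp : ∀ a, p a * p a = p a) (s t : Finset ι) :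
    (∏ a ∈ s, p a) * ∏ a ∈ t, p a = ∏ a ∈ s ∪ t, p a := by
  rw [← Finset.prod_union_inter, mul_comm,
    prod_mul_prod_of_subset hp (Finset.inter_subset_left.trans Finset.subset_union_left)]

/-- Multiply the relation by the product over `s`. The terms with `T ⊄ s` are products over strictly
larger sets and vanish by induction; the others all equal the product over `s`. So that product
equals `(s.card.choose b)` times itself, and the binomial coefficient is at least two. -/
theorem prod_eq_zero_of_esymm_eq_one [Fintype ι] {R : Type*} [CommRing R] [Algebra ℂ R] {p : ι → R}
    (hp : ∀ a, p a * p a = p a) {b : ℕ} (hb : b ≠ 0)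
    (h : ∑ T ∈ (Finset.univ : Finset ι).powersetCard b, ∏ a ∈ T, p a = 1)
    (s : Finset ι) (hs : b < s.card) : ∏ a ∈ s, p a = 0 := by
  -- Induction on the size of the complement, so that larger sets come first.
  induction hm : Fintype.card ι - s.card using Nat.strong_induction_on generalizing s with
  | _ m ih =>
    have hsub : s.powersetCard b ⊆ (Finset.univ : Finset ι).powersetCard b :=
      Finset.powersetCard_mono (Finset.subset_univ s)
    have key : ∏ a ∈ s, p a = (s.card.choose b) • ∏ a ∈ s, p a := by
      calc ∏ a ∈ s, p a
          = (∏ a ∈ s, p a) * ∑ T ∈ (Finset.univ : Finset ι).powersetCard b, ∏ a ∈ T, p a := by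
            rw [h, mul_one]
        _ = ∑ T ∈ (Finset.univ : Finset ι).powersetCard b, ∏ a ∈ s ∪ T, p a := by
            rw [Finset.mul_sum]
            exact Finset.sum_congr rfl fun T _ => prod_mul_prod_eq_prod_union hp s T
        _ = ∑ T ∈ s.powersetCard b, ∏ a ∈ s ∪ T, p a := by
            refine (Finset.sum_subset hsub fun T hT hT' => ?_).symm
            rw [Finset.mem_powersetCard] at hT hT'
            have hTs : ¬ T ⊆ s := fun hc => hT' ⟨hc, hT.2⟩
            have hlt : s.card < (s ∪ T).card := by
              refine Finset.card_lt_card (Finset.ssubset_iff_subset_ne.2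
                ⟨Finset.subset_union_left, fun he => hTs ?_⟩)
              rw [he]; exact Finset.subset_union_right
            have := Finset.card_le_univ (s ∪ T)
            exact ih (Fintype.card ι - (s ∪ T).card) (by omega) (s ∪ T) (by omega) rfl
        _ = ∑ _T ∈ s.powersetCard b, ∏ a ∈ s, p a := by
            refine Finset.sum_congr rfl fun T hT => ?_
            rw [Finset.union_eq_left.2 (Finset.mem_powersetCard.1 hT).1]
        _ = _ := by rw [Finset.sum_const, Finset.card_powersetCard]
    have h2 : 2 ≤ s.card.choose b := by
      have h3 : (b + 1).choose b ≤ s.card.choose b := Nat.choose_le_choose b hs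
      rw [Nat.choose_succ_self_right] at h3
      omega
    obtain ⟨j, hj⟩ := Nat.exists_eq_add_of_le' h2
    have h4 : ((j + 1 : ℕ) : ℂ) • ∏ a ∈ s, p a = 0 := by
      rw [Nat.cast_smul_eq_nsmul]
      rw [hj, show j + 2 = (j + 1) + 1 from rfl, succ_nsmul] at key
      simpa using key
    exact (smul_eq_zero_iff_right (by exact_mod_cast Nat.succ_ne_zero j)).1 h4

/-- For `T` of size `b`, the product over `T` is fixed by `p a` if `a ∈ T` and killed by it
otherwise, being then a product of `b + 1` factors. Hence `∑ p a` acts on each term of the partition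
of unity as the scalar `b`. -/
theorem sum_eq_of_esymm_eq_one [Fintype ι] {R : Type*} [CommRing R] [Algebra ℂ R] {p : ι → R}
    (hp : ∀ a, p a * p a = p a) {b : ℕ} (hb : b ≠ 0)
    (h : ∑ T ∈ (Finset.univ : Finset ι).powersetCard b, ∏ a ∈ T, p a = 1) :
    ∑ a, p a = b := by
  calc ∑ a, p a
      = ∑ T ∈ (Finset.univ : Finset ι).powersetCard b, ∑ a, p a * ∏ x ∈ T, p x := by
        rw [← mul_one (∑ a, p a), ← h, Finset.mul_sum]
        exact Finset.sum_congr rfl fun T _ => Finset.sum_mul _ _ _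
    _ = ∑ T ∈ (Finset.univ : Finset ι).powersetCard b, (b : R) * ∏ x ∈ T, p x := by
        refine Finset.sum_congr rfl fun T hT => ?_
        have hc := (Finset.mem_powersetCard.1 hT).2
        rw [← Finset.sum_subset (Finset.subset_univ T)]
        · rw [← hc, ← nsmul_eq_mul, ← Finset.sum_const]
          refine Finset.sum_congr rfl fun a ha => ?_
          have := prod_mul_prod_of_subset hp (Finset.singleton_subset_iff.2 ha)
          rwa [Finset.prod_singleton] at this
        · intro a _ ha
          rw [← Finset.prod_insert ha]
          refine prod_eq_zero_of_esymm_eq_one hp hb h _ ?_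
          rw [Finset.card_insert_of_notMem ha]; omega
    _ = b := by rw [← Finset.mul_sum, h, mul_one]

-- The commutative case applies inside the subalgebra generated by the `P a`.
open scoped IsMulCommutative in
theorem sum_eq_of_sum_noncommProd_eq_one [Fintype ι] {A : Type*} [Ring A] [Algebra ℂ A] {P : ι → A}
    (hP : ∀ a, P a * P a = P a) (comm : ∀ a₁ a₂, Commute (P a₁) (P a₂)) {b : ℕ} (hb : b ≠ 0)
    (h : ∑ T ∈ (Finset.univ : Finset ι).powersetCard b,
      T.noncommProd P (fun a₁ _ a₂ _ _ => comm a₁ a₂) = 1) :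
    ∑ a, P a = b := by
  have : IsMulCommutative (Algebra.adjoin ℂ (Set.range P)) := Algebra.isMulCommutative_adjoin ℂ (by
    rintro _ ⟨a, rfl⟩ _ ⟨a', rfl⟩; exact comm a a')
  let p : ι → Algebra.adjoin ℂ (Set.range P) := fun a => ⟨P a, Algebra.subset_adjoin ⟨a, rfl⟩⟩
  let f : Algebra.adjoin ℂ (Set.range P) →+* A := (Algebra.adjoin ℂ (Set.range P)).val.toRingHom
  have hf : Function.Injective f := Subtype.val_injective
  have key : ∑ a, p a = b := by
    refine sum_eq_of_esymm_eq_one (fun a => Subtype.ext (hP a)) hb (hf ?_)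
    rw [map_sum, map_one, ← h]
    refine Finset.sum_congr rfl fun T _ => ?_
    rw [← Finset.noncommProd_eq_prod]
    exact Finset.map_noncommProd T p _ f
  have := congrArg f key
  rw [map_sum, map_natCast] at this
  exact this

theorem noncommProd_mul_of_orthogonal {κ A : Type*} [DecidableEq κ] [Ring A] {R : κ → A}
    (hR : ∀ k, R k * R k = R k) (hR' : ∀ k l, k ≠ l → R k * R l = 0) (f : ι → κ)
    (T : Finset ι) (comm : (T : Set ι).Pairwise (Function.onFun Commute fun a => R (f a))) (k : κ) :
    T.noncommProd (fun a => R (f a)) comm * R k =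
      if ∀ a ∈ T, f a = k then R k else 0 := by
  induction T using Finset.induction_on with
  | empty => rw [Finset.noncommProd_empty]; simp
  | insert a s ha ih =>
    rw [Finset.noncommProd_insert_of_notMem _ _ _ _ ha, mul_assoc, ih]
    by_cases h1 : f a = k
    · subst h1
      simp [hR]
    · rw [if_neg fun h : ∀ x ∈ insert a s, f x = k => h1 (h a (Finset.mem_insert_self a s))]
      split_ifs
      · exact hR' _ _ h1
      · exact mul_zero _

/-- Cut down by one `R k` at a time: the product over `T` survives only if `T` lies in the fiber
over `k`, and among sets of size `b` only the fiber itself does. The case `b = 0` is included, with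
empty fibers. -/
theorem sum_noncommProd_of_fibers {κ A : Type*} [Fintype ι] [Fintype κ] [DecidableEq κ] [Ring A]
    {R : κ → A} (hR : ∀ k, R k * R k = R k) (hR' : ∀ k l, k ≠ l → R k * R l = 0)
    (hsum : ∑ k, R k = 1) (f : ι → κ) {b : ℕ}
    (hf : ∀ k, (Finset.univ.filter fun a => f a = k).card = b)
    (comm : ∀ a₁ a₂, Commute (R (f a₁)) (R (f a₂))) :
    ∑ T ∈ (Finset.univ : Finset ι).powersetCard b,
      T.noncommProd (fun a => R (f a)) (fun a₁ _ a₂ _ _ => comm a₁ a₂) = 1 := by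
  rw [← mul_one (Finset.sum _ _), ← hsum, Finset.mul_sum]
  refine Finset.sum_congr rfl fun k _ => ?_
  rw [Finset.sum_mul]
  refine (Finset.sum_congr rfl
    (fun T _ => noncommProd_mul_of_orthogonal hR hR' f T _ k)).trans ?_
  rw [Finset.sum_eq_single (Finset.univ.filter fun a => f a = k)]
  · rw [if_pos]
    intro a ha
    exact (Finset.mem_filter.1 ha).2
  · intro T hT hne
    rw [if_neg]
    intro hall
    refine hne (Finset.eq_of_subset_of_card_le (fun a ha => by simp [hall a ha]) ?_)
    rw [hf, (Finset.mem_powersetCard.1 hT).2]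
  · intro h
    exact absurd (Finset.mem_powersetCard.2 ⟨Finset.subset_univ _, hf k⟩) h

end Idempotents

/-! ### Spectral projections of a representation of a finite abelian group -/

section CharacterProjections

variable {F A : Type*} [AddCommGroup F] [Fintype F] [Ring A] [Algebra ℂ A]

/-- The projection onto the vectors on which `z` acts by the inverse of the character `ψ`. -/
def charProj (z : F → A) (ψ : AddChar F ℂ) : A := (Fintype.card F : ℂ)⁻¹ • ∑ g, ψ g • z g

theorem charProj_mul {z : F → A} (hz : ∀ g h, z g * z h = z (g + h)) (ψ : AddChar F ℂ) (h : F) :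
    charProj z ψ * z h = ψ (-h) • charProj z ψ := by
  rw [charProj, smul_mul_assoc, smul_comm (ψ (-h)) (_ : ℂ), Finset.sum_mul]
  congr 1
  rw [Finset.smul_sum]
  refine Fintype.sum_equiv (Equiv.addRight h) _ (fun g => ψ (-h) • ψ g • z g) fun g => ?_
  rw [Equiv.coe_addRight, smul_mul_assoc, hz, smul_smul, ← AddChar.map_add_eq_mul,
    show -h + (g + h) = g by abel]

theorem mul_charProj {z : F → A} (hz : ∀ g h, z g * z h = z (g + h)) (ψ : AddChar F ℂ) (h : F) :
    z h * charProj z ψ = ψ (-h) • charProj z ψ := by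
  rw [← charProj_mul hz, charProj, smul_mul_assoc, mul_smul_comm, Finset.sum_mul, Finset.mul_sum]
  congr 1
  refine Finset.sum_congr rfl fun g _ => ?_
  rw [mul_smul_comm, smul_mul_assoc, hz, hz, add_comm]

theorem sum_mul_char [DecidableEq (AddChar F ℂ)] (ψ φ : AddChar F ℂ) :
    ∑ g, ψ g * φ (-g) = if ψ = φ then (Fintype.card F : ℂ) else 0 := by
  have h := AddChar.sum_eq_ite (ψ - φ)
  simp only [AddChar.sub_apply', AddChar.map_neg_eq_inv, sub_eq_zero] at h ⊢
  simpa [div_eq_mul_inv] using h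

theorem charProj_mul_charProj [DecidableEq (AddChar F ℂ)] {z : F → A}
    (hz : ∀ g h, z g * z h = z (g + h)) (ψ φ : AddChar F ℂ) :
    charProj z ψ * charProj z φ = if ψ = φ then charProj z ψ else 0 := by
  have h0 : (Fintype.card F : ℂ) ≠ 0 := by exact_mod_cast Fintype.card_ne_zero
  rw [charProj.eq_1 z φ, mul_smul_comm, Finset.mul_sum]
  simp only [mul_smul_comm, charProj_mul hz, smul_smul]
  rw [← Finset.sum_smul]
  have := sum_mul_char φ ψ
  rw [this, smul_smul]
  by_cases h : ψ = φ
  · subst h; rw [if_pos rfl, if_pos rfl, inv_mul_cancel₀ h0, one_smul]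
  · rw [if_neg h, if_neg (Ne.symm h), mul_zero, zero_smul]

theorem sum_charProj (z : F → A) : ∑ ψ : AddChar F ℂ, charProj z ψ = z 0 := by
  classical
  have h0 : (Fintype.card F : ℂ) ≠ 0 := by exact_mod_cast Fintype.card_ne_zero
  simp only [charProj]
  rw [← Finset.smul_sum, Finset.sum_comm]
  simp only [← Finset.sum_smul, AddChar.sum_apply_eq_ite]
  simp [smul_smul]

theorem star_charProj [StarRing A] [StarModule ℂ A] {z : F → A}
    (hs : ∀ g, star (z g) = z (-g)) (ψ : AddChar F ℂ) : star (charProj z ψ) = charProj z ψ := by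
  rw [charProj, star_smul, star_sum]
  congr 1
  · simp
  · refine Fintype.sum_equiv (Equiv.neg F) _ _ fun g => ?_
    rw [Equiv.neg_apply, star_smul, hs, AddChar.map_neg_eq_conj]
    rfl

end CharacterProjections

/-! ### Matrix units of a von Neumann algebra of matrices -/

section MatrixUnits

variable {n : ℕ}

/-- The spectrum is finite, so every function is continuous on it and the indicators of points can
be put into the functional calculus. The commutation clause will place the spectral projections in a
bicommutant. -/
theorem exists_spectral_resolution {a : Matrix (Fin n) (Fin n) ℂ} (ha : IsSelfAdjoint a) :
    ∃ (s : Finset ℝ) (f : ℝ → Matrix (Fin n) (Fin n) ℂ), (∀ l, IsStarProjection (f l)) ∧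
      ∑ l ∈ s, f l = 1 ∧ (∀ l, a * f l = (l : ℂ) • f l) ∧ ∀ l b, Commute a b → Commute (f l) b := by
  have hfin : (spectrum ℝ a).Finite := Matrix.finite_real_spectrum
  have hc : ∀ g : ℝ → ℝ, ContinuousOn g (spectrum ℝ a) := fun g => hfin.continuousOn g
  refine ⟨hfin.toFinset, fun l => cfc (fun x => if x = l then 1 else 0 : ℝ → ℝ) a,
    fun l => ⟨?_, cfc_predicate _ a⟩, ?_, fun l => ?_, fun l b hb => hb.cfc_real _⟩
  · rw [IsIdempotentElem, ← cfc_mul _ _ a (hc _) (hc _)]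
    congr 1; ext x; split_ifs <;> simp
  · rw [← cfc_sum _ a _ (fun _ _ => hc _), ← cfc_const_one ℝ a]
    refine cfc_congr fun x hx => ?_
    simp [Finset.sum_apply, Finset.sum_ite_eq, hx]
  · have h1 := cfc_mul (fun x : ℝ => x) (fun x => if x = l then 1 else 0) a (hc _) (hc _)
    rw [cfc_id' ℝ a] at h1
    refine h1.symm.trans ?_
    have : ((l : ℂ) • cfc (fun x => if x = l then 1 else 0 : ℝ → ℝ) a) =
        l • cfc (fun x => if x = l then 1 else 0 : ℝ → ℝ) a := by
      ext i j; simp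
    refine Eq.trans ?_ this.symm
    rw [← cfc_const_mul _ _ a (hc _)]
    congr 1; ext x; split_ifs with h <;> simp [h]

/-- A partition of unity into nonzero projections of `M`. -/
structure IsProjectionPartition {ι : Type*} [Fintype ι]
    (M : StarSubalgebra ℂ (Matrix (Fin n) (Fin n) ℂ)) (q : ι → Matrix (Fin n) (Fin n) ℂ) :
    Prop where
  mem : ∀ i, q i ∈ M
  proj : ∀ i, IsStarProjection (q i)
  ne_zero : ∀ i, q i ≠ 0
  orth : ∀ i j, i ≠ j → q i * q j = 0
  sum : ∑ i, q i = 1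

variable {M : StarSubalgebra ℂ (Matrix (Fin n) (Fin n) ℂ)}

theorem IsProjectionPartition.linearIndependent {ι : Type*} [Fintype ι]
    {q : ι → Matrix (Fin n) (Fin n) ℂ} (h : IsProjectionPartition M q) :
    LinearIndependent ℂ q := by
  rw [Fintype.linearIndependent_iff]
  intro c hc i
  have h1 := congrArg (· * q i) hc
  simp only [Finset.sum_mul, zero_mul, smul_mul_assoc] at h1
  rw [Finset.sum_eq_single i (fun j _ hj => by rw [h.orth j i hj, smul_zero]) (by simp),
    (h.proj i).isIdempotentElem.eq] at h1
  exact (smul_eq_zero.1 h1).resolve_right (h.ne_zero i)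

theorem IsProjectionPartition.card_le {ι : Type*} [Fintype ι]
    {q : ι → Matrix (Fin n) (Fin n) ℂ} (h : IsProjectionPartition M q) :
    Fintype.card ι ≤ Module.finrank ℂ (Matrix (Fin n) (Fin n) ℂ) :=
  h.linearIndependent.fintype_card_le_finrank

theorem IsProjectionPartition.reindex {ι κ : Type*} [Fintype ι] [Fintype κ]
    {q : ι → Matrix (Fin n) (Fin n) ℂ} (h : IsProjectionPartition M q) (e : κ ≃ ι) :
    IsProjectionPartition M (q ∘ e) where
  mem i := h.mem _
  proj i := h.proj _
  ne_zero i := h.ne_zero _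
  orth i j hij := h.orth _ _ (fun he => hij (e.injective he))
  sum := by rw [← h.sum]; exact e.sum_comp q

/-- The piece `q i` is replaced by `f` and `q i - f`, which makes the partition longer by one; this
contradicts maximality later on. -/
theorem IsProjectionPartition.split {ι : Type*} [Fintype ι]
    {q : ι → Matrix (Fin n) (Fin n) ℂ} (h : IsProjectionPartition M q) {i : ι}
    {f : Matrix (Fin n) (Fin n) ℂ} (hfM : f ∈ M) (hf : IsStarProjection f) (hfq : f * q i = f)
    (h0 : f ≠ 0) (h1 : f ≠ q i) : ∃ q' : Option ι → Matrix (Fin n) (Fin n) ℂ,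
      IsProjectionPartition M q' := by
  classical
  have hqf : q i * f = f := by
    have := congrArg star hfq
    rwa [star_mul, hf.isSelfAdjoint.star_eq, (h.proj i).isSelfAdjoint.star_eq] at this
  have hff := hf.isIdempotentElem.eq
  have hqq := fun j => (h.proj j).isIdempotentElem.eq
  have hfj : ∀ j, j ≠ i → f * q j = 0 := fun j hj => by
    rw [← hfq, mul_assoc, h.orth i j (Ne.symm hj), mul_zero]
  have hjf : ∀ j, j ≠ i → q j * f = 0 := fun j hj => by
    rw [← hqf, ← mul_assoc, h.orth j i hj, zero_mul]
  refine ⟨fun o => o.elim f fun j => if j = i then q i - f else q j, ?_, ?_, ?_, ?_, ?_⟩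
  · rintro (_ | j)
    · exact hfM
    · dsimp only [Option.elim]
      split_ifs
      · exact sub_mem (h.mem i) hfM
      · exact h.mem j
  · rintro (_ | j)
    · exact hf
    · dsimp only [Option.elim]
      split_ifs
      · refine ⟨?_, (h.proj i).isSelfAdjoint.sub hf.isSelfAdjoint⟩
        rw [IsIdempotentElem, sub_mul, mul_sub, mul_sub, hqq, hqf, hfq, hff]
        abel
      · exact h.proj j
  · rintro (_ | j)
    · exact h0
    · dsimp only [Option.elim]
      split_ifs
      · exact sub_ne_zero.2 (Ne.symm h1)
      · exact h.ne_zero j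
  · rintro (_ | j) (_ | l) hjl
    · exact absurd rfl hjl
    · dsimp only [Option.elim]
      split_ifs with hl
      · rw [mul_sub, hfq, hff, sub_self]
      · exact hfj l hl
    · dsimp only [Option.elim]
      split_ifs with hl
      · rw [sub_mul, hqf, hff, sub_self]
      · exact hjf j hl
    · have hjl' : j ≠ l := fun he => hjl (congrArg some he)
      dsimp only [Option.elim]
      split_ifs with hj hl hl
      · exact absurd (hj.trans hl.symm) hjl'
      · rw [sub_mul, hfj l hl, sub_zero, h.orth i l (Ne.symm hl)]
      · rw [mul_sub, hjf j hj, sub_zero, h.orth j i hj]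
      · exact h.orth j l hjl'
  · rw [Fintype.sum_option]
    dsimp only [Option.elim]
    have : ∀ j, (if j = i then q i - f else q j) = q j - if j = i then f else 0 := by
      intro j; split_ifs with hj
      · rw [hj]
      · rw [sub_zero]
    simp only [this, Finset.sum_sub_distrib, h.sum, Finset.sum_ite_eq', Finset.mem_univ, if_true]
    abel

/-- A partition of unity into projections of `M` that do not split in `M`. -/
theorem exists_minimal_projectionPartition
    (M : StarSubalgebra ℂ (Matrix (Fin n) (Fin n) ℂ)) :
    ∃ (r : ℕ) (q : Fin r → Matrix (Fin n) (Fin n) ℂ), IsProjectionPartition M q ∧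
      ∀ i, ∀ f ∈ M, IsStarProjection f → f * q i = f → f = 0 ∨ f = q i := by
  classical
  let P : ℕ → Prop := fun r => ∃ q : Fin r → Matrix (Fin n) (Fin n) ℂ, IsProjectionPartition M q
  have hbound : ∀ r, P r → r ≤ Module.finrank ℂ (Matrix (Fin n) (Fin n) ℂ) := by
    rintro r ⟨q, hq⟩
    simpa using hq.card_le
  have hex : ∃ r, P r := by
    -- For `n = 0` the identity vanishes and only the empty partition has nonzero members.
    by_cases h1 : (1 : Matrix (Fin n) (Fin n) ℂ) = 0
    · exact ⟨0, Fin.elim0, fun i => i.elim0, fun i => i.elim0, fun i => i.elim0,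
        fun i => i.elim0, by simp [h1]⟩
    · exact ⟨1, fun _ => 1, fun _ => one_mem M, fun _ => .one _, fun _ => h1,
        fun i j hij => absurd (Subsingleton.elim i j) hij, by simp⟩
  obtain ⟨r0, hr0⟩ := hex
  have hspec := Nat.findGreatest_spec (P := P) (hbound r0 hr0) hr0
  obtain ⟨q, hq⟩ := hspec
  refine ⟨_, q, hq, fun i f hfM hf hfq => ?_⟩
  by_contra! hne
  obtain ⟨q', hq'⟩ := hq.split hfM hf hfq hne.1 hne.2
  have h2 : P (Nat.findGreatest P (Module.finrank ℂ (Matrix (Fin n) (Fin n) ℂ)) + 1) :=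
    ⟨_, hq'.reindex (Fintype.equivOfCardEq (by simp))⟩
  exact absurd (Nat.le_findGreatest (hbound _ h2) h2) (by omega)

/-- For self-adjoint `y`, the spectral projections of `q y q` lie in `M'' = M` and commute with `q`.
One of them meets `q`, so by minimality it dominates `q`, and `q y q` is its eigenvalue times `q`.
-/
theorem exists_smul_of_not_split
    (hM : Set.centralizer (Set.centralizer (M : Set (Matrix (Fin n) (Fin n) ℂ))) = M)
    {q : Matrix (Fin n) (Fin n) ℂ} (hqM : q ∈ M) (hq : IsStarProjection q) (h0 : q ≠ 0)
    (hmin : ∀ f ∈ M, IsStarProjection f → f * q = f → f = 0 ∨ f = q)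
    {x : Matrix (Fin n) (Fin n) ℂ} (hx : x ∈ M) : ∃ c : ℂ, q * x * q = c • q := by
  have hqq := hq.isIdempotentElem.eq
  have key : ∀ y ∈ M, IsSelfAdjoint y → ∃ c : ℂ, q * y * q = c • q := by
    intro y hy hsa
    have haM : q * y * q ∈ M := mul_mem (mul_mem hqM hy) hqM
    have ha : IsSelfAdjoint (q * y * q) := by
      have := hsa.conjugate q
      rwa [hq.isSelfAdjoint.star_eq] at this
    obtain ⟨s, f, hf, hsum, haf, hcomm⟩ := exists_spectral_resolution ha
    have hl : ∃ l, q * f l ≠ 0 := by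
      by_contra! hall
      apply h0
      rw [← mul_one q, ← hsum, Finset.mul_sum]
      exact Finset.sum_eq_zero fun l _ => hall l
    obtain ⟨l, hl⟩ := hl
    have hfM : f l ∈ M := by
      have : f l ∈ Set.centralizer (Set.centralizer (M : Set (Matrix (Fin n) (Fin n) ℂ))) := by
        intro b hb
        have : Commute (q * y * q) b := hb _ haM
        exact (hcomm l b this).symm
      rwa [hM] at this
    have hfq : Commute (f l) q := by
      refine hcomm l q ?_
      rw [Commute, SemiconjBy, mul_assoc, hqq, ← mul_assoc, ← mul_assoc, hqq]
    have hqf : q * f l = q := by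
      refine (hmin (q * f l) (mul_mem hqM hfM) ?_ ?_).resolve_left hl
      · refine ⟨?_, ?_⟩
        · rw [IsIdempotentElem, mul_assoc, ← mul_assoc (f l), hfq.eq, mul_assoc,
            (hf l).isIdempotentElem.eq, ← mul_assoc, hqq]
        · rw [isSelfAdjoint_iff, star_mul, (hf l).isSelfAdjoint.star_eq,
            hq.isSelfAdjoint.star_eq, hfq.eq]
      · rw [mul_assoc, hfq.eq, ← mul_assoc, hqq]
    refine ⟨l, ?_⟩
    calc q * y * q = q * (q * y * q) * q := by simp only [mul_assoc, hqq]; rw [← mul_assoc q q, hqq]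
      _ = q * (q * y * q) * (q * f l) := by rw [hqf]
      _ = q * (q * y * q * f l) := by simp only [mul_assoc]; rw [← mul_assoc q q (f l), hqq]
      _ = (l : ℂ) • q := by rw [haf, mul_smul_comm, hqf]
  -- A general `x` is a combination of two self-adjoint elements of `M`.
  obtain ⟨c₁, hc₁⟩ := key (x + star x) (add_mem hx (star_mem hx)) (IsSelfAdjoint.add_star_self x)
  obtain ⟨c₂, hc₂⟩ := key (Complex.I • (x - star x))
    (M.smul_mem (sub_mem hx (star_mem hx)) _) (by
      rw [isSelfAdjoint_iff, star_smul, star_sub, star_star]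
      simp only [RCLike.star_def, Complex.conj_I, neg_smul, smul_sub]; abel)
  refine ⟨(c₁ - Complex.I * c₂) / 2, ?_⟩
  have hx' : x = (2 : ℂ)⁻¹ • ((x + star x) - Complex.I • (Complex.I • (x - star x))) := by
    rw [smul_smul, Complex.I_mul_I, neg_smul, one_smul, sub_neg_eq_add,
      show x + star x + (x - star x) = (2 : ℂ) • x by rw [two_smul]; abel, smul_smul]
    norm_num
  rw [hx', mul_smul_comm, smul_mul_assoc, mul_sub, sub_mul, hc₁, mul_smul_comm, smul_mul_assoc, hc₂,
    smul_smul, ← sub_smul, smul_smul]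
  congr 1; ring

/-- `v ∈ M` is a partial isometry with initial projection `q` and final projection `p`. -/
def IsPartialIsometryBetween (M : StarSubalgebra ℂ (Matrix (Fin n) (Fin n) ℂ))
    (p q v : Matrix (Fin n) (Fin n) ℂ) : Prop :=
  v ∈ M ∧ star v * v = q ∧ v * star v = p ∧ p * v = v

/-- For `y = p x q` the element `y* y` lies in the corner of `q`, hence is `c q`, and comparing
traces gives `c > 0`. The partial isometry is `y` divided by the square root of `c`. -/
theorem exists_isPartialIsometryBetween
    {p q : Matrix (Fin n) (Fin n) ℂ} (hpM : p ∈ M) (hqM : q ∈ M) (hp : IsStarProjection p)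
    (hq : IsStarProjection q) (hp0 : p ≠ 0) (hq0 : q ≠ 0)
    (hpc : ∀ x ∈ M, ∃ c : ℂ, p * x * p = c • p) (hqc : ∀ x ∈ M, ∃ c : ℂ, q * x * q = c • q)
    {x : Matrix (Fin n) (Fin n) ℂ} (hx : x ∈ M) (hpxq : p * x * q ≠ 0) :
    ∃ v, IsPartialIsometryBetween M p q v := by
  have hpp := hp.isIdempotentElem.eq
  have hqq := hq.isIdempotentElem.eq
  have htr : ∀ y : Matrix (Fin n) (Fin n) ℂ, y ≠ 0 → 0 < (star y * y).trace := fun y hy =>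
    lt_of_le_of_ne (Matrix.posSemidef_conjTranspose_mul_self y).trace_nonneg
      (fun h => hy (Matrix.trace_conjTranspose_mul_self_eq_zero_iff.1 h.symm))
  obtain ⟨c, hc⟩ := hqc (star x * p * x) (mul_mem (mul_mem (star_mem hx) hpM) hx)
  have hyy : star (p * x * q) * (p * x * q) = c • q := by
    rw [← hc, star_mul, star_mul, hp.isSelfAdjoint.star_eq, hq.isSelfAdjoint.star_eq]
    simp only [mul_assoc]
    rw [← mul_assoc p p, hpp]
  have hcpos : 0 < c := by
    have h1 := htr _ hpxq
    have h2 := htr q hq0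
    rw [hyy, Matrix.trace_smul, smul_eq_mul] at h1
    rw [hq.isSelfAdjoint.star_eq, hqq] at h2
    rw [← mul_div_cancel_right₀ c h2.ne']
    exact div_pos h1 h2
  obtain ⟨s, hs, hsc⟩ : ∃ s : ℝ, s ≠ 0 ∧ c = (s : ℂ) * s := by
    rw [Complex.lt_def] at hcpos
    refine ⟨Real.sqrt c.re, (Real.sqrt_pos.2 hcpos.1).ne', ?_⟩
    rw [← Complex.ofReal_mul, Real.mul_self_sqrt hcpos.1.le]
    exact Complex.ext rfl hcpos.2.symm
  have hs' : (s : ℂ) ≠ 0 := by exact_mod_cast hs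
  set v := (s : ℂ)⁻¹ • (p * x * q) with hv
  have hvM : v ∈ M := M.smul_mem (mul_mem (mul_mem hpM hx) hqM) _
  have hvv : star v * v = q := by
    rw [hv, star_smul, smul_mul_smul_comm, hyy, smul_smul, hsc]
    simp only [RCLike.star_def, map_inv₀, Complex.conj_ofReal]
    rw [show (s : ℂ)⁻¹ * (s : ℂ)⁻¹ * (s * s) = 1 by field_simp, one_smul]
  have hpv : p * v = v := by
    rw [hv, mul_smul_comm, ← mul_assoc, ← mul_assoc, hpp]
  have hvq : v * q = v := by
    rw [hv, smul_mul_assoc, mul_assoc (p * x), hqq]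
  have hvp : star v * p = star v := by
    have := congrArg star hpv
    rwa [star_mul, hp.isSelfAdjoint.star_eq] at this
  refine ⟨v, hvM, hvv, ?_, hpv⟩
  -- `v v*` is a nonzero idempotent of the form `c' p`, so `c' = 1`.
  obtain ⟨c', hc'⟩ := hpc (v * star v) (mul_mem hvM (star_mem hvM))
  rw [← mul_assoc, hpv, mul_assoc, hvp] at hc'
  have hid : v * star v * (v * star v) = v * star v := by
    rw [mul_assoc, ← mul_assoc (star v), hvv, ← mul_assoc, hvq]
  rw [hc', smul_mul_smul_comm, hpp] at hid
  have hcc : c' * c' = c' := smul_left_injective ℂ hp0 hid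
  have hc0 : c' ≠ 0 := by
    rintro rfl
    rw [zero_smul] at hc'
    have h3 : v = 0 := by
      rw [← hvq, ← hvv, ← mul_assoc, hc', zero_mul]
    rw [h3, mul_zero] at hvv
    exact hq0 hvv.symm
  rw [hc', mul_left_cancel₀ hc0 (hcc.trans (mul_one c').symm), one_smul]

theorem IsPartialIsometryBetween.mul_right {p q v : Matrix (Fin n) (Fin n) ℂ}
    (h : IsPartialIsometryBetween M p q v) : v * q = v := by
  rw [← h.2.1, ← mul_assoc, h.2.2.1, h.2.2.2]

theorem IsPartialIsometryBetween.star_mul_left {p q v : Matrix (Fin n) (Fin n) ℂ}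
    (h : IsPartialIsometryBetween M p q v) (hp : IsStarProjection p) : star v * p = star v := by
  have := congrArg star h.2.2.2
  rwa [star_mul, hp.isSelfAdjoint.star_eq] at this

theorem IsPartialIsometryBetween.symm {p q v : Matrix (Fin n) (Fin n) ℂ}
    (h : IsPartialIsometryBetween M p q v) (hq : IsStarProjection q) :
    IsPartialIsometryBetween M q p (star v) := by
  refine ⟨star_mem h.1, by rw [star_star, h.2.2.1], by rw [star_star, h.2.1], ?_⟩
  have := congrArg star h.mul_right
  rwa [star_mul, hq.isSelfAdjoint.star_eq] at this

theorem IsPartialIsometryBetween.trans {p q r v w : Matrix (Fin n) (Fin n) ℂ}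
    (h : IsPartialIsometryBetween M p q v) (h' : IsPartialIsometryBetween M q r w) :
    IsPartialIsometryBetween M p r (v * w) := by
  refine ⟨mul_mem h.1 h'.1, ?_, ?_, ?_⟩
  · rw [star_mul, mul_assoc, ← mul_assoc (star v), h.2.1, h'.2.2.2, h'.2.1]
  · rw [star_mul, mul_assoc, ← mul_assoc w, h'.2.2.1, ← mul_assoc, h.mul_right, h.2.2.1]
  · rw [← mul_assoc, h.2.2.2]

/-- A full system of matrix units of `M`, with blocks indexed by `κ`. -/
structure MatrixUnits (M : StarSubalgebra ℂ (Matrix (Fin n) (Fin n) ℂ)) (κ : Type) [Fintype κ]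
    (d : κ → ℕ) [∀ k, NeZero (d k)] where
  e : ∀ k, ZMod (d k) → ZMod (d k) → Matrix (Fin n) (Fin n) ℂ
  mem : ∀ k i j, e k i j ∈ M
  star_e : ∀ k i j, star (e k i j) = e k j i
  mul_e : ∀ k i j l, e k i j * e k j l = e k i l
  mul_of_ne : ∀ k i j l m, j ≠ l → e k i j * e k l m = 0
  mul_of_block_ne : ∀ k k' i j l m, k ≠ k' → e k i j * e k' l m = 0
  ne_zero : ∀ k i, e k i i ≠ 0
  sum_e : ∑ k, ∑ i, e k i i = 1
  span_e : ∀ x ∈ M, x ∈ Submodule.span ℂ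
    (Set.range fun p : Σ k, ZMod (d k) × ZMod (d k) => e p.1 p.2.1 p.2.2)

/-- Blocks are the equivalence classes of minimal projections under partial isometries in `M`. With
`v i` carrying the chosen representative of the class to `q i`, the matrix units are `v i * star (v
j)`. -/
theorem exists_matrixUnits
    (hM : Set.centralizer (Set.centralizer (M : Set (Matrix (Fin n) (Fin n) ℂ))) = M) :
    ∃ (κ : Type) (_ : Fintype κ) (_ : DecidableEq κ) (d : κ → ℕ) (_ : ∀ k, NeZero (d k)),
      Nonempty (MatrixUnits M κ d) := by
  classical
  obtain ⟨r, q, hq, hmin⟩ := exists_minimal_projectionPartition M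
  have hsc : ∀ i, ∀ x ∈ M, ∃ c : ℂ, q i * x * q i = c • q i := fun i x hx =>
    exists_smul_of_not_split hM (hq.mem i) (hq.proj i) (hq.ne_zero i) (hmin i) hx
  have hqq := fun i => (hq.proj i).isIdempotentElem.eq
  let S : Setoid (Fin r) :=
    { r := fun i j => ∃ v, IsPartialIsometryBetween M (q i) (q j) v
      iseqv :=
        { refl := fun i => ⟨q i, hq.mem i, by rw [(hq.proj i).isSelfAdjoint.star_eq, hqq],
            by rw [(hq.proj i).isSelfAdjoint.star_eq, hqq], hqq i⟩
          symm := fun {i j} ⟨v, hv⟩ => ⟨star v, hv.symm (hq.proj j)⟩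
          trans := fun ⟨v, hv⟩ ⟨w, hw⟩ => ⟨v * w, hv.trans hw⟩ } }
  have hrep : ∀ i : Fin r, ∃ v, IsPartialIsometryBetween M (q i) (q (Quotient.mk S i).out) v :=
    fun i => S.symm (Quotient.mk_out i)
  choose v hv using hrep
  let d : Quotient S → ℕ := fun k => Fintype.card {i // Quotient.mk S i = k}
  have hd : ∀ k, NeZero (d k) := fun k => ⟨by
    obtain ⟨i, hi⟩ := Quotient.exists_rep k
    have : Nonempty {i // Quotient.mk S i = k} := ⟨⟨i, hi⟩⟩
    exact Fintype.card_ne_zero⟩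
  -- Any bijection serves; cyclic labels are wanted for the shifts in the Weyl unitaries.
  let σ : ∀ k, ZMod (d k) ≃ {i // Quotient.mk S i = k} := fun k =>
    Fintype.equivOfCardEq (ZMod.card (d k))
  have hvv : ∀ i j l m : Fin r, j ≠ l → v i * star (v j) * (v l * star (v m)) = 0 := by
    intro i j l m hjl
    rw [mul_assoc, ← mul_assoc (star (v j)), ← (hv j).star_mul_left (hq.proj j),
      ← (hv l).2.2.2, mul_assoc (star (v j)), ← mul_assoc (q j), hq.orth j l hjl, zero_mul,
      mul_zero, zero_mul, mul_zero]
  have hvm : ∀ i j l : Fin r, Quotient.mk S i = Quotient.mk S j →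
      v i * star (v j) * (v j * star (v l)) = v i * star (v l) := by
    intro i j l hij
    rw [mul_assoc, ← mul_assoc (star (v j)), (hv j).2.1, ← hij, ← mul_assoc, (hv i).mul_right]
  refine ⟨Quotient S, inferInstance, inferInstance, d, hd, ⟨⟨fun k i j =>
    v (σ k i) * star (v (σ k j)), ?_, ?_, ?_, ?_, ?_, ?_, ?_, ?_⟩⟩⟩
  · exact fun k i j => mul_mem (hv _).1 (star_mem (hv _).1)
  · intro k i j
    rw [star_mul, star_star]
  · exact fun k i j l => hvm _ _ _ ((σ k i).2.trans (σ k j).2.symm)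
  · exact fun k i j l m hjl => hvv _ _ _ _
      (fun h => hjl ((σ k).injective (Subtype.ext h)))
  · exact fun k k' i j l m hk => hvv _ _ _ _
      (fun h => hk (by rw [← (σ k j).2, ← (σ k' l).2, h]))
  · intro k i
    rw [(hv _).2.2.1]
    exact hq.ne_zero _
  · rw [← hq.sum, ← (Equiv.sigmaFiberEquiv (Quotient.mk S)).sum_comp q, Fintype.sum_sigma]
    refine Finset.sum_congr rfl fun k _ => ?_
    rw [← (σ k).sum_comp]
    exact Finset.sum_congr rfl fun i _ => (hv _).2.2.1
  · intro x hx
    have hsum : x = ∑ i, ∑ j, q i * x * q j := by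
      simp only [← Finset.mul_sum, ← Finset.sum_mul, hq.sum, one_mul, mul_one]
    rw [hsum]
    refine Submodule.sum_mem _ fun i _ => Submodule.sum_mem _ fun j _ => ?_
    by_cases h0 : q i * x * q j = 0
    · rw [h0]; exact Submodule.zero_mem _
    · have hij : Quotient.mk S i = Quotient.mk S j := Quotient.sound
        (exists_isPartialIsometryBetween (hq.mem i) (hq.mem j) (hq.proj i) (hq.proj j)
          (hq.ne_zero i) (hq.ne_zero j) (hsc i) (hsc j) hx h0)
      -- The partial isometry moves `q i * x * q j` into the corner of `q i`, where it is a scalar.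
      obtain ⟨c, hc⟩ := hsc i (x * (v j * star (v i)))
        (mul_mem hx (mul_mem (hv j).1 (star_mem (hv i).1)))
      have h1 : q i * x * q j = c • (v i * star (v j)) := by
        have h2 := congrArg (· * (v i * star (v j))) hc
        simp only [smul_mul_assoc] at h2
        rw [← mul_assoc (q i) (v i), (hv i).2.2.2] at h2
        rw [← h2, ← (hv j).2.2.1]
        have h3 := hvm j i j hij.symm
        rw [← h3]
        have h4 : q i * (v i * star (v j)) = v i * star (v j) := by
          rw [← mul_assoc, (hv i).2.2.2]
        rw [mul_assoc (q i * (x * (v j * star (v i)))), h4]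
        simp only [mul_assoc]
      rw [h1]
      refine Submodule.smul_mem _ _ (Submodule.subset_span
        ⟨⟨Quotient.mk S j, (σ _).symm ⟨i, hij⟩, (σ _).symm ⟨j, rfl⟩⟩, ?_⟩)
      simp only [Equiv.apply_symm_apply]

end MatrixUnits

/-! ### Dimension, conditional expectation and weighted trace in terms of matrix units. -/

section MatrixUnitsLemmas

variable {n : ℕ} {M : StarSubalgebra ℂ (Matrix (Fin n) (Fin n) ℂ)} {κ : Type} [Fintype κ]
  {d : κ → ℕ} [∀ k, NeZero (d k)]

namespace MatrixUnits

variable (E : MatrixUnits M κ d)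

theorem e_ne_zero (k : κ) (i j : ZMod (d k)) : E.e k i j ≠ 0 := fun h =>
  E.ne_zero k i (by rw [← E.mul_e k i j i, h, zero_mul])

theorem linearIndependent : LinearIndependent ℂ
    (fun p : Σ k, ZMod (d k) × ZMod (d k) => E.e p.1 p.2.1 p.2.2) := by
  classical
  rw [Fintype.linearIndependent_iff]
  rintro c hc ⟨k, i, j⟩
  have h1 := congrArg (fun x => E.e k i i * x * E.e k j j) hc
  simp only [Finset.mul_sum, Finset.sum_mul, mul_zero, zero_mul, smul_mul_assoc,
    mul_smul_comm] at h1
  rw [Finset.sum_eq_single ⟨k, i, j⟩] at h1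
  · rw [E.mul_e, E.mul_e] at h1
    exact (smul_eq_zero.1 h1).resolve_right (E.e_ne_zero k i j)
  · rintro ⟨k', i', j'⟩ _ hne
    by_cases hk : k' = k
    · subst hk
      by_cases hi : i = i'
      · subst hi
        have hj : j' ≠ j := fun hj => hne (by rw [hj])
        rw [E.mul_e, E.mul_of_ne _ _ _ _ _ hj, smul_zero]
      · rw [E.mul_of_ne _ _ _ _ _ hi, zero_mul, smul_zero]
    · rw [E.mul_of_block_ne _ _ _ _ _ _ (Ne.symm hk), zero_mul, smul_zero]
  · simp

theorem finrank_eq (E : MatrixUnits M κ d) : Module.finrank ℂ M = ∑ k, d k ^ 2 := by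
  have h1 : Subalgebra.toSubmodule M.toSubalgebra = Submodule.span ℂ
      (Set.range fun p : Σ k, ZMod (d k) × ZMod (d k) => E.e p.1 p.2.1 p.2.2) := by
    refine le_antisymm (fun x hx => E.span_e x hx) (Submodule.span_le.2 ?_)
    rintro _ ⟨p, rfl⟩
    exact E.mem _ _ _
  have h2 : Module.finrank ℂ M = Module.finrank ℂ (Subalgebra.toSubmodule M.toSubalgebra) := rfl
  rw [h2, h1, finrank_span_eq_card E.linearIndependent, Fintype.card_sigma]
  refine Finset.sum_congr rfl fun k _ => ?_
  rw [Fintype.card_prod, ZMod.card, sq]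

/-- The central projection of a block. -/
def blockProj (k : κ) : Matrix (Fin n) (Fin n) ℂ := ∑ i, E.e k i i

theorem sum_blockProj : ∑ k, E.blockProj k = 1 := E.sum_e

theorem blockProj_mul_e (k : κ) (i j : ZMod (d k)) : E.blockProj k * E.e k i j = E.e k i j := by
  rw [blockProj, Finset.sum_mul, Finset.sum_eq_single i, E.mul_e]
  · exact fun l _ hl => E.mul_of_ne _ _ _ _ _ hl
  · simp

/-- `X ↦ ∑ e_ij X e_ji` maps onto the commutant of `M`. -/
def average (k : κ) (X : Matrix (Fin n) (Fin n) ℂ) : Matrix (Fin n) (Fin n) ℂ :=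
  ∑ i, ∑ j, E.e k i j * X * E.e k j i

theorem mem_centralizer_of_commute_e {Y : Matrix (Fin n) (Fin n) ℂ}
    (h : ∀ k i j, E.e k i j * Y = Y * E.e k i j) :
    Y ∈ Set.centralizer (M : Set (Matrix (Fin n) (Fin n) ℂ)) := by
  intro x hx
  have hx' := E.span_e x hx
  clear hx
  induction hx' using Submodule.span_induction with
  | mem x hx => obtain ⟨p, rfl⟩ := hx; exact h _ _ _
  | zero => rw [zero_mul, mul_zero]
  | add x y _ _ hx hy => rw [add_mul, mul_add, hx, hy]
  | smul c x _ hx => rw [smul_mul_assoc, mul_smul_comm, hx]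

theorem average_mem_centralizer (k : κ) (X : Matrix (Fin n) (Fin n) ℂ) :
    E.average k X ∈ Set.centralizer (M : Set (Matrix (Fin n) (Fin n) ℂ)) := by
  refine E.mem_centralizer_of_commute_e fun k' l m => ?_
  simp only [average, Finset.mul_sum, Finset.sum_mul]
  by_cases hk : k' = k
  · subst hk
    refine (Finset.sum_eq_single m (fun i _ hi => Finset.sum_eq_zero fun j _ => ?_)
      (by simp)).trans (Eq.trans ?_ (Finset.sum_eq_single l
        (fun i _ hi => Finset.sum_eq_zero fun j _ => ?_) (by simp)).symm)
    · rw [← mul_assoc, ← mul_assoc, E.mul_of_ne _ _ _ _ _ (Ne.symm hi), zero_mul, zero_mul]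
    · refine Finset.sum_congr rfl fun j _ => ?_
      rw [mul_assoc (E.e k' l j * X), E.mul_e, ← mul_assoc, ← mul_assoc, E.mul_e]
    · rw [mul_assoc (E.e k' i j * X), E.mul_of_ne _ _ _ _ _ hi, mul_zero]
  · refine (Finset.sum_eq_zero fun i _ => Finset.sum_eq_zero fun j _ => ?_).trans
      (Finset.sum_eq_zero fun i _ => Finset.sum_eq_zero fun j _ => ?_).symm
    · rw [← mul_assoc, ← mul_assoc, E.mul_of_block_ne _ _ _ _ _ _ hk, zero_mul, zero_mul]
    · rw [mul_assoc (E.e k i j * X), E.mul_of_block_ne _ _ _ _ _ _ (Ne.symm hk), mul_zero]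

theorem blockProj_mul_average (k : κ) (X : Matrix (Fin n) (Fin n) ℂ) :
    E.blockProj k * E.average k X = E.average k X := by
  simp only [average, Finset.mul_sum]
  refine Finset.sum_congr rfl fun i _ => Finset.sum_congr rfl fun j _ => ?_
  rw [← mul_assoc, ← mul_assoc, E.blockProj_mul_e]

theorem star_blockProj (k : κ) : star (E.blockProj k) = E.blockProj k := by
  simp only [blockProj, star_sum, E.star_e]

/-- Under the trace, `e_ji` cycles to the front, passes `Z` and merges with `e_ij` into `e_jj`,
independently of `i`. -/
theorem trace_mul_average {Z : Matrix (Fin n) (Fin n) ℂ}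
    (hZ : Z ∈ Set.centralizer (M : Set (Matrix (Fin n) (Fin n) ℂ))) (k : κ)
    (X : Matrix (Fin n) (Fin n) ℂ) :
    (Z * E.average k X).trace = d k * (Z * E.blockProj k * X).trace := by
  simp only [average, blockProj, Finset.mul_sum, Finset.sum_mul, Matrix.trace_sum]
  rw [Finset.sum_comm, ← Finset.mul_sum]
  simp only [Finset.mul_sum]
  refine Finset.sum_congr rfl fun j _ => ?_
  have : ∀ i, (Z * (E.e k i j * X * E.e k j i)).trace = (Z * E.e k j j * X).trace := fun i => by
    rw [← mul_assoc, ← mul_assoc, Matrix.trace_mul_comm, ← mul_assoc, ← mul_assoc,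
      hZ _ (E.mem k j i), mul_assoc Z, E.mul_e]
  simp only [this]
  rw [Finset.sum_const, Finset.card_univ, ZMod.card, nsmul_eq_mul]

/-- The average `A` lies in `M'` and is supported on the block, so `Tr(A* A)` is `d k` times `Tr(A*
X)`, which vanishes. -/
theorem average_eq_zero {X : Matrix (Fin n) (Fin n) ℂ}
    (hX : X ∈ tracePerp (Set.centralizer (M : Set (Matrix (Fin n) (Fin n) ℂ)))) (k : κ) :
    E.average k X = 0 := by
  have hm := E.average_mem_centralizer k X
  have hs : star (E.average k X) ∈ Set.centralizer (M : Set (Matrix (Fin n) (Fin n) ℂ)) :=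
    Set.star_mem_centralizer' (fun a ha => star_mem ha) hm
  have h1 := E.trace_mul_average hs k X
  have h2 : star (E.average k X) * E.blockProj k = star (E.average k X) := by
    rw [← E.star_blockProj, ← star_mul, E.blockProj_mul_average]
  rw [h2, hX _ hm, mul_zero] at h1
  exact Matrix.trace_conjTranspose_mul_self_eq_zero_iff.1 h1

/-- The trace preserving conditional expectation onto the commutant of `M`. -/
def condExp (X : Matrix (Fin n) (Fin n) ℂ) : Matrix (Fin n) (Fin n) ℂ :=
  ∑ k, (d k : ℂ)⁻¹ • E.average k X

theorem condExp_mem_centralizer (X : Matrix (Fin n) (Fin n) ℂ) :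
    E.condExp X ∈ Set.centralizer (M : Set (Matrix (Fin n) (Fin n) ℂ)) := by
  intro x hx
  simp only [condExp, Finset.mul_sum, Finset.sum_mul]
  refine Finset.sum_congr rfl fun k _ => ?_
  rw [mul_smul_comm, smul_mul_assoc, E.average_mem_centralizer k X x hx]

theorem sub_condExp_mem_tracePerp (X : Matrix (Fin n) (Fin n) ℂ) :
    X - E.condExp X ∈ tracePerp (Set.centralizer (M : Set (Matrix (Fin n) (Fin n) ℂ))) := by
  intro Y hY
  have hs : star Y ∈ Set.centralizer (M : Set (Matrix (Fin n) (Fin n) ℂ)) :=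
    Set.star_mem_centralizer' (fun a ha => star_mem ha) hY
  rw [mul_sub, Matrix.trace_sub, sub_eq_zero, condExp, Finset.mul_sum, Matrix.trace_sum]
  conv_lhs => rw [← mul_one (star Y), ← E.sum_blockProj, Finset.mul_sum, Finset.sum_mul,
    Matrix.trace_sum]
  refine Finset.sum_congr rfl fun k _ => ?_
  have hd : (d k : ℂ) ≠ 0 := by exact_mod_cast NeZero.ne (d k)
  rw [mul_smul_comm, Matrix.trace_smul, E.trace_mul_average hs, smul_eq_mul,
    inv_mul_cancel_left₀ hd]

theorem trace_e_of_ne (k : κ) {i j : ZMod (d k)} (h : i ≠ j) : (E.e k i j).trace = 0 := by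
  rw [← E.mul_e k i j j, Matrix.trace_mul_comm, E.mul_of_ne _ _ _ _ _ (Ne.symm h),
    Matrix.trace_zero]

theorem trace_e_self (k : κ) (i j : ZMod (d k)) : (E.e k i i).trace = (E.e k j j).trace := by
  rw [← E.mul_e k i j i, Matrix.trace_mul_comm, E.mul_e]

theorem trace_e_ne_zero (k : κ) (i : ZMod (d k)) : (E.e k i i).trace ≠ 0 := by
  rw [← E.mul_e k i i i]
  nth_rewrite 1 [← E.star_e]
  exact fun h => E.ne_zero k i (Matrix.trace_conjTranspose_mul_self_eq_zero_iff.1 h)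

/-- The density of the trace on `M` whose value on a minimal projection of a block is the size of
the block. -/
theorem exists_density (E : MatrixUnits M κ d) : ∃ D : Matrix (Fin n) (Fin n) ℂ, star D = D ∧
    (∀ k i j, (D * E.e k i j).trace = if i = j then (d k : ℂ) else 0) ∧
    D.trace = (Module.finrank ℂ M : ℂ) := by
  -- The denominator is the multiplicity of the block in `ℂⁿ`, the matrix trace of its minimal
  -- projections; the coefficient replaces it by `d l`. Block `k` then contributes `d k` minimal
  -- projections of weight `d k` to the trace of `D`.
  have key : ∀ k i j, ((∑ l, ((d l : ℂ) / (E.e l 0 0).trace) • E.blockProj l) * E.e k i j).trace =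
      if i = j then (d k : ℂ) else 0 := by
    intro k i j
    rw [Finset.sum_mul, Finset.sum_eq_single k]
    · rw [smul_mul_assoc, E.blockProj_mul_e, Matrix.trace_smul, smul_eq_mul]
      split_ifs with h
      · subst h
        rw [E.trace_e_self k i 0, div_mul_cancel₀ _ (E.trace_e_ne_zero k 0)]
      · rw [E.trace_e_of_ne k h, mul_zero]
    · intro l _ hl
      rw [smul_mul_assoc, blockProj, Finset.sum_mul, Finset.sum_eq_zero, smul_zero]
      exact fun m _ => E.mul_of_block_ne _ _ _ _ _ _ hl
    · simp
  refine ⟨_, ?_, key, ?_⟩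
  · rw [star_sum]
    refine Finset.sum_congr rfl fun l _ => ?_
    have : star (E.e l 0 0).trace = (E.e l 0 0).trace := by
      rw [← Matrix.trace_conjTranspose, ← Matrix.star_eq_conjTranspose, E.star_e]
    rw [star_smul, E.star_blockProj, star_div₀, this, star_natCast]
  · rw [← mul_one (∑ l, ((d l : ℂ) / (E.e l 0 0).trace) • E.blockProj l), ← E.sum_e,
      Finset.mul_sum, Matrix.trace_sum, E.finrank_eq, Nat.cast_sum]
    refine Finset.sum_congr rfl fun k _ => ?_
    rw [Finset.mul_sum, Matrix.trace_sum]
    simp only [key, if_true]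
    rw [Finset.sum_const, Finset.card_univ, ZMod.card, nsmul_eq_mul, sq, Nat.cast_mul]

end MatrixUnits

end MatrixUnitsLemmas

/-! ### Elementary tensors and slices -/

section Slice

variable {n : ℕ} {H : Type*} [NormedAddCommGroup H] [InnerProductSpace ℂ H]

theorem tmul_mul_tmul (x x' : Matrix (Fin n) (Fin n) ℂ) (y y' : H →L[ℂ] H) :
    tmul x y * tmul x' y' = tmul (x * x') (y * y') := by
  ext1 i j
  simp only [tmul, Matrix.mul_apply, Matrix.of_apply, Finset.sum_smul]
  exact Finset.sum_congr rfl fun l _ => smul_mul_smul_comm _ _ _ _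

theorem star_tmul [CompleteSpace H] (x : Matrix (Fin n) (Fin n) ℂ) (y : H →L[ℂ] H) :
    star (tmul x y) = tmul (star x) (star y) := by
  ext1 i j
  simp only [tmul, Matrix.star_apply, Matrix.of_apply, star_smul]

theorem tmul_add (x x' : Matrix (Fin n) (Fin n) ℂ) (y : H →L[ℂ] H) :
    tmul (x + x') y = tmul x y + tmul x' y := by
  ext1 i j
  simp only [tmul, Matrix.add_apply, Matrix.of_apply, add_smul]

theorem tmul_smul (c : ℂ) (x : Matrix (Fin n) (Fin n) ℂ) (y : H →L[ℂ] H) :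
    tmul (c • x) y = c • tmul x y := by
  ext1 i j
  simp only [tmul, Matrix.smul_apply, Matrix.of_apply, smul_assoc]

/-- `x ↦ x ⊗ y` as a linear map. -/
def tmulLinear (y : H →L[ℂ] H) :
    Matrix (Fin n) (Fin n) ℂ →ₗ[ℂ] Matrix (Fin n) (Fin n) (H →L[ℂ] H) where
  toFun x := tmul x y
  map_add' x x' := tmul_add x x' y
  map_smul' c x := tmul_smul c x y

theorem tmul_one_one : tmul (1 : Matrix (Fin n) (Fin n) ℂ) (1 : H →L[ℂ] H) = 1 := by
  ext1 i j
  simp only [tmul, Matrix.of_apply, Matrix.one_apply]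
  split_ifs <;> simp

theorem tmul_mem_vnTensor [CompleteSpace H] {M : StarSubalgebra ℂ (Matrix (Fin n) (Fin n) ℂ)}
    {N : VonNeumannAlgebra H} {x : Matrix (Fin n) (Fin n) ℂ} (hx : x ∈ M) {y : H →L[ℂ] H}
    (hy : y ∈ N) : tmul x y ∈ vnTensor M N :=
  Set.subset_centralizer_centralizer ⟨x, hx, y, hy, rfl⟩

theorem commute_tmul_one_of_mem_vnTensor [CompleteSpace H]
    {M : StarSubalgebra ℂ (Matrix (Fin n) (Fin n) ℂ)}
    {N : VonNeumannAlgebra H} {P : Matrix (Fin n) (Fin n) (H →L[ℂ] H)} (hP : P ∈ vnTensor M N)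
    {Y : Matrix (Fin n) (Fin n) ℂ}
    (hY : Y ∈ Set.centralizer (M : Set (Matrix (Fin n) (Fin n) ℂ))) :
    P * tmul Y 1 = tmul Y 1 * P := by
  refine (hP (tmul Y 1) ?_).symm
  rintro _ ⟨x, hx, y, -, rfl⟩
  rw [tmul_mul_tmul, tmul_mul_tmul, hY x hx, mul_one, one_mul]

/-- The slice of `P` by the functional `X ↦ Tr(D X)`. -/
def slice (D : Matrix (Fin n) (Fin n) ℂ) (P : Matrix (Fin n) (Fin n) (H →L[ℂ] H)) : H →L[ℂ] H :=
  ∑ s, ∑ t, D t s • P s t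

theorem slice_sum {ι : Type*} (D : Matrix (Fin n) (Fin n) ℂ) (s : Finset ι)
    (P : ι → Matrix (Fin n) (Fin n) (H →L[ℂ] H)) :
    slice D (∑ a ∈ s, P a) = ∑ a ∈ s, slice D (P a) := by
  simp only [slice, Matrix.sum_apply, Finset.smul_sum]
  rw [Finset.sum_comm]
  simp only [Finset.sum_comm (s := s)]
  rw [Finset.sum_comm]

theorem slice_natCast (D : Matrix (Fin n) (Fin n) ℂ) (b : ℕ) :
    slice D (b : Matrix (Fin n) (Fin n) (H →L[ℂ] H)) = ((b : ℂ) * D.trace) • 1 := by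
  have : ∀ s t : Fin n, D t s • (b : Matrix (Fin n) (Fin n) (H →L[ℂ] H)) s t =
      if s = t then (D s s * b) • (1 : H →L[ℂ] H) else 0 := by
    intro s t
    rw [← Matrix.diagonal_natCast, Matrix.diagonal_apply]
    split_ifs with h
    · subst h
      rw [mul_smul, Nat.cast_smul_eq_nsmul, nsmul_one]
    · rw [smul_zero]
  simp only [slice, this, Finset.sum_ite_eq, Finset.mem_univ, if_true]
  rw [← Finset.sum_smul, ← Finset.sum_mul, mul_comm]
  rfl

theorem star_slice [CompleteSpace H] {D : Matrix (Fin n) (Fin n) ℂ} (hD : star D = D)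
    {P : Matrix (Fin n) (Fin n) (H →L[ℂ] H)} (hP : star P = P) :
    star (slice D P) = slice D P := by
  simp only [slice, star_sum, star_smul]
  rw [Finset.sum_comm]
  refine Finset.sum_congr rfl fun s _ => Finset.sum_congr rfl fun t _ => ?_
  rw [← Matrix.star_apply, ← Matrix.star_apply, hD, hP]

/-! ### The lower bound: slices of coloring projections. -/

variable {M : StarSubalgebra ℂ (Matrix (Fin n) (Fin n) ℂ)} {κ : Type} [Fintype κ]
  {d : κ → ℕ} [∀ k, NeZero (d k)]

theorem sum_comm_three {α β : Type*} [Fintype α] [AddCommMonoid β] (f : α → α → α → β) :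
    ∑ s, ∑ t, ∑ w, f s t w = ∑ w, ∑ s, ∑ t, f s t w :=
  (Finset.sum_congr rfl fun _ _ => Finset.sum_comm).trans Finset.sum_comm

/-- Expanding the conditional expectation, the term for `e_ij X e_ji` contributes `Tr(D e_ij) e_ji`.
The weight `d k` on the diagonal cancels the factor `(d k)⁻¹` of the expectation, leaving `∑ e_ii =
1`. This is what dictates the choice of `D`. -/
theorem sum_mul_condExp_single (E : MatrixUnits M κ d) {D : Matrix (Fin n) (Fin n) ℂ}
    (hD : ∀ k i j, (D * E.e k i j).trace = if i = j then (d k : ℂ) else 0) (u w : Fin n) :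
    ∑ s, ∑ t, D t s * E.condExp (Matrix.single t u 1) s w = (1 : Matrix (Fin n) (Fin n) ℂ) u w := by
  have h1 : ∀ k i j, ∑ s, ∑ t, D t s * (E.e k i j * Matrix.single t u (1 : ℂ) * E.e k j i) s w =
      (if i = j then (d k : ℂ) else 0) * E.e k j i u w := by
    intro k i j
    rw [← hD k i j, Matrix.trace, Finset.sum_mul, Finset.sum_comm]
    refine Finset.sum_congr rfl fun t _ => ?_
    rw [Matrix.diag_apply, Matrix.mul_apply, Finset.sum_mul]
    refine Finset.sum_congr rfl fun s _ => ?_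
    rw [mul_assoc (D t s)]
    congr 1
    rw [Matrix.mul_apply, Finset.sum_eq_single u]
    · rw [Matrix.mul_single_apply_same, mul_one]
    · intro v _ hv
      rw [Matrix.mul_single_apply_of_ne _ _ _ _ _ hv, zero_mul]
    · simp
  have h2 : ∀ s t, D t s * E.condExp (Matrix.single t u 1) s w = ∑ k, (d k : ℂ)⁻¹ * ∑ i, ∑ j,
      D t s * (E.e k i j * Matrix.single t u (1 : ℂ) * E.e k j i) s w := by
    intro s t
    simp only [MatrixUnits.condExp, MatrixUnits.average, Matrix.sum_apply, Matrix.smul_apply,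
      smul_eq_mul, Finset.mul_sum]
    refine Finset.sum_congr rfl fun k _ => Finset.sum_congr rfl fun i _ =>
      Finset.sum_congr rfl fun j _ => mul_left_comm _ _ _
  have h3 : ∀ k, ∑ s, ∑ t, (d k : ℂ)⁻¹ * ∑ i, ∑ j,
      D t s * (E.e k i j * Matrix.single t u (1 : ℂ) * E.e k j i) s w = ∑ i, E.e k i i u w := by
    intro k
    have hd : (d k : ℂ) ≠ 0 := by exact_mod_cast NeZero.ne (d k)
    have : ∑ s, ∑ t, ∑ i, ∑ j, D t s * (E.e k i j * Matrix.single t u (1 : ℂ) * E.e k j i) s w =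
        ∑ i, ∑ j, (if i = j then (d k : ℂ) else 0) * E.e k j i u w := by
      simp only [← h1]
      calc _ = ∑ s, ∑ i, ∑ j, ∑ t,
            D t s * (E.e k i j * Matrix.single t u (1 : ℂ) * E.e k j i) s w := by
            refine Finset.sum_congr rfl fun s _ => ?_
            rw [Finset.sum_comm]
            exact Finset.sum_congr rfl fun i _ => Finset.sum_comm
        _ = _ := by
            rw [Finset.sum_comm]
            exact Finset.sum_congr rfl fun i _ => Finset.sum_comm
    have hpull : ∑ s, ∑ t, (d k : ℂ)⁻¹ * ∑ i, ∑ j,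
        D t s * (E.e k i j * Matrix.single t u (1 : ℂ) * E.e k j i) s w = (d k : ℂ)⁻¹ *
        ∑ s, ∑ t, ∑ i, ∑ j, D t s * (E.e k i j * Matrix.single t u (1 : ℂ) * E.e k j i) s w := by
      simp only [Finset.mul_sum]
    rw [hpull, this]
    simp only [ite_mul, zero_mul, Finset.sum_ite_eq, Finset.mem_univ, if_true]
    rw [← Finset.mul_sum, inv_mul_cancel_left₀ hd]
  simp only [h2]
  calc _ = ∑ k, ∑ s, ∑ t, (d k : ℂ)⁻¹ * ∑ i, ∑ j,
      D t s * (E.e k i j * Matrix.single t u (1 : ℂ) * E.e k j i) s w := by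
        rw [Finset.sum_comm (s := (Finset.univ : Finset κ))]
        exact Finset.sum_congr rfl fun s _ => Finset.sum_comm
    _ = _ := by
        simp only [h3]
        rw [← E.sum_e]
        simp only [Matrix.sum_apply]

/-- The hypothesis at a matrix unit `X` expresses a product of two entries of `P` linearly in the
entries of `P`. Weighting by `D` twice, the inner sum collapses by `sum_mul_condExp_single` and one
slice remains. -/
theorem slice_mul_slice (E : MatrixUnits M κ d) {D : Matrix (Fin n) (Fin n) ℂ}
    (hD : ∀ k i j, (D * E.e k i j).trace = if i = j then (d k : ℂ) else 0)
    {P : Matrix (Fin n) (Fin n) (H →L[ℂ] H)}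
    (hP : ∀ X, P * tmul X 1 * P = tmul (E.condExp X) 1 * P) :
    slice D P * slice D P = slice D P := by
  have h1 : ∀ s t u v, P s t * P u v = ∑ w, E.condExp (Matrix.single t u 1) s w • P w v := by
    intro s t u v
    have h : (P * tmul (Matrix.single t u 1) (1 : H →L[ℂ] H) * P) s v =
        (tmul (E.condExp (Matrix.single t u 1)) (1 : H →L[ℂ] H) * P) s v := by rw [hP]
    have h' : ∀ w, (P * tmul (Matrix.single t u 1) (1 : H →L[ℂ] H)) s w =
        if w = u then P s t else 0 := by
      intro w
      rw [Matrix.mul_apply, Finset.sum_eq_single t]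
      · simp only [tmul, Matrix.of_apply, Matrix.single_apply]
        by_cases hw : w = u
        · simp [hw]
        · simp [hw, Ne.symm hw]
      · intro x _ hx
        simp [tmul, Matrix.single_apply, Ne.symm hx]
      · simp
    rw [Matrix.mul_apply, Matrix.mul_apply] at h
    simp only [h', ite_mul, zero_mul, Finset.sum_ite_eq', Finset.mem_univ, if_true] at h
    rw [h]
    refine Finset.sum_congr rfl fun w _ => ?_
    simp [tmul]
  have h2 : slice D P * slice D P = ∑ u, ∑ v, D v u • ∑ w,
      (∑ s, ∑ t, D t s * E.condExp (Matrix.single t u 1) s w) • P w v := by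
    simp only [slice, Finset.sum_mul_sum, Finset.sum_smul, Finset.smul_sum]
    have h3 : ∀ s t u v, (D t s • P s t) * (D v u • P u v) = ∑ w, D v u •
        (D t s * E.condExp (Matrix.single t u 1) s w) • P w v := by
      intro s t u v
      rw [smul_mul_smul_comm, h1, Finset.smul_sum]
      refine Finset.sum_congr rfl fun w _ => ?_
      rw [smul_smul, smul_smul]
      congr 1; ring
    simp only [h3]
    refine Finset.sum_comm.trans (Finset.sum_congr rfl fun u _ => ?_)
    exact (sum_comm_three _).trans (Finset.sum_congr rfl fun v _ => sum_comm_three _)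
  rw [h2]
  simp only [sum_mul_condExp_single E hD, Matrix.one_apply, ite_smul, one_smul, zero_smul,
    Finset.sum_ite_eq, Finset.mem_univ, if_true]
  rfl

theorem norm_le_one_of_isStarProjection [CompleteSpace H] {p : H →L[ℂ] H}
    (h : star p = p) (h' : p * p = p) :
    ‖p‖ ≤ 1 := by
  have h1 := CStarRing.norm_star_mul_self (x := p)
  rw [h, h'] at h1
  nlinarith [norm_nonneg p]

/-- A `b`-fold coloring of the complete quantum graph of `M` uses at least `b * dim M` colors. -/
theorem mul_finrank_le_of_isBFoldColoring [CompleteSpace H] [Nontrivial H]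
    (hM : Set.centralizer (Set.centralizer (M : Set (Matrix (Fin n) (Fin n) ℂ))) = M)
    (N : VonNeumannAlgebra H) {b c : ℕ} {P : Fin c → Matrix (Fin n) (Fin n) (H →L[ℂ] H)}
    (h : IsBFoldColoring (completeQuantumGraph M hM) N b P) :
    b * Module.finrank ℂ M ≤ c := by
  rcases eq_or_ne b 0 with rfl | hb
  · simp
  obtain ⟨κ, _, _, d, _, ⟨E⟩⟩ := exists_matrixUnits hM
  obtain ⟨D, hDs, hD, hDt⟩ := E.exists_density
  obtain ⟨hmem, hproj, ⟨comm, hsum⟩, hperp⟩ := h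
  have hsumP : ∑ a, P a = (b : Matrix (Fin n) (Fin n) (H →L[ℂ] H)) :=
    sum_eq_of_sum_noncommProd_eq_one (fun a => (hproj a).isIdempotentElem.eq) comm hb hsum
  -- The part of `X` orthogonal to `M'` is killed by condition (3); the part in `M'` commutes with
  -- `P a`.
  have hPX : ∀ a X, P a * tmul X 1 * P a = tmul (E.condExp X) 1 * P a := by
    intro a X
    have h1 := hperp a _ (E.sub_condExp_mem_tracePerp X)
    have h2 : tmul X (1 : H →L[ℂ] H) = tmul (X - E.condExp X) 1 + tmul (E.condExp X) 1 := by
      rw [← tmul_add, sub_add_cancel]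
    rw [h2, mul_add, add_mul, h1, zero_add,
      commute_tmul_one_of_mem_vnTensor (hmem a) (E.condExp_mem_centralizer X), mul_assoc,
      (hproj a).isIdempotentElem.eq]
  have hnorm : ∀ a, ‖slice D (P a)‖ ≤ 1 := fun a => norm_le_one_of_isStarProjection
    (star_slice hDs (hproj a).isSelfAdjoint.star_eq) (slice_mul_slice E hD (hPX a))
  have h1 : ∑ a, slice D (P a) = ((b * Module.finrank ℂ M : ℕ) : ℂ) • (1 : H →L[ℂ] H) := by
    rw [← slice_sum, hsumP, slice_natCast, hDt, Nat.cast_mul]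
  have h2 := norm_sum_le (Finset.univ) fun a => slice D (P a)
  rw [h1, norm_smul, norm_one, mul_one, Complex.norm_natCast] at h2
  have h3 : ∑ a, ‖slice D (P a)‖ ≤ c := by
    refine (Finset.sum_le_sum fun a _ => hnorm a).trans ?_
    simp
  exact_mod_cast h2.trans h3

end Slice

/-! ### The Hilbert space of square summable functions -/

section EllTwo

variable {G : Type}

/-- The Hilbert space `ℓ²(G)`. -/
abbrev EllTwo (G : Type) : Type := lp (fun _ : G => ℂ) 2

/-- The linear isometry of `ℓ²(G)` that permutes the coordinates and multiplies them by phases. -/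
def phasePerm (e : G ≃ G) (c : G → ℂ) (hc : ∀ h, ‖c h‖ = 1) : EllTwo G →ₗᵢ[ℂ] EllTwo G where
  toFun f := ⟨fun h => c h * f (e h), by
    refine memℓp_gen ?_
    have := (lp.memℓp f).summable (by norm_num)
    simp only [norm_mul, hc, one_mul]
    exact e.summable_iff.2 this⟩
  map_add' f f' := by
    ext h
    exact mul_add _ _ _
  map_smul' z f := by
    ext h
    exact mul_left_comm _ _ _
  norm_map' f := by
    rw [lp.norm_eq_tsum_rpow (by norm_num), lp.norm_eq_tsum_rpow (by norm_num)]
    congr 1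
    simp only [LinearMap.coe_mk, AddHom.coe_mk, norm_mul, hc, one_mul]
    exact e.tsum_eq fun h => ‖f h‖ ^ (2 : ENNReal).toReal

/-- The canonical basis vectors of `ℓ²(G)`. -/
def delta (g : G) : EllTwo G := by
  classical exact lp.single 2 g 1

theorem inner_delta (g : G) (f : EllTwo G) : ⟪delta g, f⟫_ℂ = f g := by
  classical
  rw [delta, lp.inner_single_left]
  simp

theorem delta_self (g : G) : delta g g = 1 := by
  classical exact lp.single_apply_self _ _ _

theorem delta_of_ne {g h : G} (hgh : h ≠ g) : delta g h = 0 := by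
  classical exact lp.single_apply_ne _ _ _ hgh

theorem norm_delta (g : G) : ‖delta g‖ = 1 := by
  classical
  rw [delta, lp.norm_single (by norm_num), norm_one]

theorem hasSum_delta (f : EllTwo G) : HasSum (fun g => f g • delta g) f := by
  classical
  have h := lp.hasSum_single (p := 2) (by norm_num) f
  have h2 : ∀ g, lp.single 2 g (f g) = f g • delta g := fun g => by
    rw [delta, ← lp.single_smul, smul_eq_mul, mul_one]
  simpa only [h2] using h

theorem ext_delta {x y : EllTwo G →L[ℂ] EllTwo G} (h : ∀ g, x (delta g) = y (delta g)) :
    x = y := by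
  ext1 f
  have hx := x.hasSum (hasSum_delta f)
  have hy := y.hasSum (hasSum_delta f)
  simp only [map_smul, h] at hx hy
  exact hx.unique hy

theorem linearIndependent_delta : LinearIndependent ℂ (delta : G → EllTwo G) := by
  rw [linearIndependent_iff']
  intro s c hc g hg
  have h := congrArg (fun f => ⟪delta g, f⟫_ℂ) hc
  simp only [inner_sum, inner_smul_right, inner_zero_right, inner_delta] at h
  rw [Finset.sum_eq_single g] at h
  · simpa [delta_self] using h
  · intro k _ hk
    rw [delta_of_ne (Ne.symm hk), mul_zero]
  · exact fun h => absurd hg h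

instance separableSpace_ellTwo [Countable G] : TopologicalSpace.SeparableSpace (EllTwo G) := by
  rw [← TopologicalSpace.isSeparable_univ_iff]
  have h1 : TopologicalSpace.IsSeparable
      (Submodule.span ℂ (Set.range (delta : G → EllTwo G)) : Set (EllTwo G)) :=
    (Set.countable_range _).isSeparable.span
  refine h1.closure.mono fun f _ => ?_
  refine mem_closure_of_tendsto (hasSum_delta f) (Eventually.of_forall fun s => ?_)
  exact Submodule.sum_mem _ fun g _ => Submodule.smul_mem _ _ (Submodule.subset_span ⟨g, rfl⟩)

instance finiteDimensional_ellTwo [Finite G] : FiniteDimensional ℂ (EllTwo G) :=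
  FiniteDimensional.of_injective
    ({ toFun := fun f => (f : G → ℂ), map_add' := fun _ _ => rfl, map_smul' := fun _ _ => rfl } :
      EllTwo G →ₗ[ℂ] (G → ℂ)) fun _ _ h => lp.ext h

end EllTwo

/-! ### Twisted group von Neumann algebras of abelian groups -/

section Twisted

/-- A unimodular bicharacter on an abelian group. -/
structure Bicharacter (G : Type) [AddCommGroup G] where
  toFun : G → G → ℂ
  add_left : ∀ g h k, toFun (g + h) k = toFun g k * toFun h k
  add_right : ∀ g h k, toFun g (h + k) = toFun g h * toFun g k
  norm_eq_one : ∀ g h, ‖toFun g h‖ = 1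

variable {G : Type} [AddCommGroup G]

namespace Bicharacter

variable (β : Bicharacter G)

theorem ne_zero (g h : G) : β.toFun g h ≠ 0 := by
  rw [← norm_ne_zero_iff, β.norm_eq_one]; exact one_ne_zero

theorem zero_left (g : G) : β.toFun 0 g = 1 := by
  have := β.add_left 0 0 g
  rw [add_zero] at this
  exact (mul_eq_left₀ (β.ne_zero 0 g)).1 this.symm

theorem zero_right (g : G) : β.toFun g 0 = 1 := by
  have := β.add_right g 0 0
  rw [add_zero] at this
  exact (mul_eq_left₀ (β.ne_zero g 0)).1 this.symm

theorem self_mul_neg_right (g h : G) : β.toFun g h * β.toFun g (-h) = 1 := by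
  rw [← β.add_right, add_neg_cancel, β.zero_right]

theorem self_mul_neg_left (g h : G) : β.toFun g h * β.toFun (-g) h = 1 := by
  rw [← β.add_left, add_neg_cancel, β.zero_left]

theorem neg_left_eq_neg_right (g h : G) : β.toFun (-g) h = β.toFun g (-h) :=
  mul_left_cancel₀ (β.ne_zero g h) ((β.self_mul_neg_left g h).trans (β.self_mul_neg_right g h).symm)

end Bicharacter

variable (β : Bicharacter G)

/-- The twisted left translations. -/
def leftTranslation (g : G) : EllTwo G →L[ℂ] EllTwo G :=
  (phasePerm (Equiv.subRight g) (fun h => β.toFun g (h - g))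
    fun _ => β.norm_eq_one _ _).toContinuousLinearMap

/-- The twisted right translations. -/
def rightTranslation (g : G) : EllTwo G →L[ℂ] EllTwo G :=
  (phasePerm (Equiv.subRight g) (fun h => β.toFun (h - g) g)
    fun _ => β.norm_eq_one _ _).toContinuousLinearMap

theorem leftTranslation_apply (g : G) (f : EllTwo G) (h : G) :
    leftTranslation β g f h = β.toFun g (h - g) * f (h - g) := rfl

theorem rightTranslation_apply (g : G) (f : EllTwo G) (h : G) :
    rightTranslation β g f h = β.toFun (h - g) g * f (h - g) := rfl

theorem leftTranslation_mul (g h : G) :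
    leftTranslation β g * leftTranslation β h = β.toFun g h • leftTranslation β (g + h) := by
  ext f x
  change leftTranslation β g (leftTranslation β h f) x =
    β.toFun g h * leftTranslation β (g + h) f x
  simp only [leftTranslation_apply]
  rw [show x - g = (x - (g + h)) + h by abel, β.add_right, add_sub_cancel_right, β.add_left]
  ring

theorem leftTranslation_zero : leftTranslation β 0 = 1 := by
  ext f x
  change leftTranslation β 0 f x = f x
  rw [leftTranslation_apply, β.zero_left, sub_zero, one_mul]

/-- The adjoint is a left inverse because the translation is isometric, and the right-hand side is a
right inverse; the two must agree. -/
theorem star_leftTranslation (g : G) :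
    star (leftTranslation β g) = β.toFun g g • leftTranslation β (-g) := by
  have h1 : star (leftTranslation β g) * leftTranslation β g = 1 := by
    rw [ContinuousLinearMap.star_eq_adjoint]
    exact (ContinuousLinearMap.norm_map_iff_adjoint_comp_self _).1
      fun f => (phasePerm (Equiv.subRight g) (fun h => β.toFun g (h - g))
        fun _ => β.norm_eq_one _ _).norm_map f
  have h2 : leftTranslation β g * (β.toFun g g • leftTranslation β (-g)) = 1 := by
    rw [mul_smul_comm, leftTranslation_mul, smul_smul, β.self_mul_neg_right, one_smul,
      add_neg_cancel, leftTranslation_zero]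
  rw [← mul_one (star (leftTranslation β g)), ← h2, ← mul_assoc, h1, one_mul]

theorem leftTranslation_mul_rightTranslation (g k : G) :
    leftTranslation β g * rightTranslation β k = rightTranslation β k * leftTranslation β g := by
  ext f x
  change leftTranslation β g (rightTranslation β k f) x =
    rightTranslation β k (leftTranslation β g f) x
  simp only [leftTranslation_apply, rightTranslation_apply]
  rw [show x - g - k = x - k - g by abel, show x - g = (x - k - g) + k by abel, β.add_right,
    show x - k = (x - k - g) + g by abel, β.add_left, add_sub_cancel_right]
  ring

theorem leftTranslation_delta (g h : G) :
    leftTranslation β g (delta h) = β.toFun g h • delta (g + h) := by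
  ext x
  change _ = β.toFun g h * delta (g + h) x
  rw [leftTranslation_apply]
  by_cases hx : x = g + h
  · subst hx
    rw [add_sub_cancel_left, delta_self, delta_self]
  · rw [delta_of_ne hx, delta_of_ne (fun h' => hx (by rw [← h']; abel)), mul_zero, mul_zero]

theorem rightTranslation_delta_zero (g : G) : rightTranslation β g (delta 0) = delta g := by
  ext x
  rw [rightTranslation_apply]
  by_cases hx : x = g
  · subst hx
    rw [sub_self, delta_self, delta_self, β.zero_left, mul_one]
  · rw [delta_of_ne hx, delta_of_ne (sub_ne_zero.2 hx), mul_zero]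

theorem star_mem_centralizer_leftTranslation {y : EllTwo G →L[ℂ] EllTwo G}
    (hy : y ∈ Set.centralizer (Set.range (leftTranslation β))) :
    star y ∈ Set.centralizer (Set.range (leftTranslation β)) := by
  rintro _ ⟨g, rfl⟩
  have h1 := hy _ ⟨-g, rfl⟩
  have h2 := congrArg star h1
  rw [star_mul, star_mul, star_leftTranslation, neg_neg, mul_smul_comm, smul_mul_assoc] at h2
  exact (smul_right_injective _ (β.ne_zero (-g) (-g)) h2).symm

/-- The twisted group von Neumann algebra, acting on `ℓ²(G)`. -/
def twistedGroupVN : VonNeumannAlgebra (EllTwo G) where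
  carrier := Set.centralizer (Set.centralizer (Set.range (leftTranslation β)))
  mul_mem' := Set.mul_mem_centralizer
  add_mem' := Set.add_mem_centralizer
  algebraMap_mem' z := fun y _ => ((Algebra.commutes z y).symm :)
  star_mem' hx := Set.star_mem_centralizer'
    (fun _ hy => star_mem_centralizer_leftTranslation β hy) hx
  centralizer_centralizer' := Set.centralizer_centralizer_centralizer _

theorem coe_twistedGroupVN : (twistedGroupVN β : Set (EllTwo G →L[ℂ] EllTwo G)) =
    Set.centralizer (Set.centralizer (Set.range (leftTranslation β))) := rfl

theorem leftTranslation_mem (g : G) : leftTranslation β g ∈ twistedGroupVN β :=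
  Set.subset_centralizer_centralizer (Set.mem_range_self g)

variable {β}

/-- Right translations commute with the algebra and carry `δ₀` to every basis vector. Hence `δ₀` is
separating, and an element is determined by its coefficients `x δ₀`. -/
theorem apply_delta_of_mem {x : EllTwo G →L[ℂ] EllTwo G} (hx : x ∈ twistedGroupVN β) (g : G) :
    x (delta g) = rightTranslation β g (x (delta 0)) := by
  have h1 : rightTranslation β g * x = x * rightTranslation β g := by
    refine hx (rightTranslation β g) ?_
    rintro _ ⟨h, rfl⟩
    exact leftTranslation_mul_rightTranslation β h g
  rw [← rightTranslation_delta_zero β g]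
  exact (congrArg (fun y : EllTwo G →L[ℂ] EllTwo G => y (delta 0)) h1).symm

theorem eq_of_apply_delta_zero {x y : EllTwo G →L[ℂ] EllTwo G} (hx : x ∈ twistedGroupVN β)
    (hy : y ∈ twistedGroupVN β) (h : x (delta 0) = y (delta 0)) : x = y :=
  ext_delta fun g => by rw [apply_delta_of_mem hx, apply_delta_of_mem hy, h]

variable (β) in
/-- The canonical trace `x ↦ ⟪δ₀, x δ₀⟫`. -/
def canonicalTrace : (twistedGroupVN β).toStarSubalgebra →ₗ[ℂ] ℂ where
  toFun x := ⟪delta 0, (x : EllTwo G →L[ℂ] EllTwo G) (delta 0)⟫_ℂ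
  map_add' _ _ := inner_add_right _ _ _
  map_smul' _ _ := inner_smul_right _ _ _

theorem canonicalTrace_apply (x : (twistedGroupVN β).toStarSubalgebra) :
    canonicalTrace β x = ⟪delta 0, (x : EllTwo G →L[ℂ] EllTwo G) (delta 0)⟫_ℂ := rfl

theorem canonicalTrace_star_mul_self (x : (twistedGroupVN β).toStarSubalgebra) :
    canonicalTrace β (star x * x) =
      ((‖(x : EllTwo G →L[ℂ] EllTwo G) (delta 0)‖ ^ 2 : ℝ) : ℂ) := by
  have h : canonicalTrace β (star x * x) = ⟪delta 0, (star (x : EllTwo G →L[ℂ] EllTwo G))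
      ((x : EllTwo G →L[ℂ] EllTwo G) (delta 0))⟫_ℂ := rfl
  rw [h, ContinuousLinearMap.star_eq_adjoint, ContinuousLinearMap.adjoint_inner_right,
    inner_self_eq_norm_sq_to_K]
  norm_cast

/-- Traciality can be read off: since `β(-g, g) = β(g, -g)`, substituting `-g` for `g` exchanges `x`
and `y`. -/
theorem hasSum_canonicalTrace_mul (x y : (twistedGroupVN β).toStarSubalgebra) :
    HasSum (fun g => β.toFun (-g) g * (x : EllTwo G →L[ℂ] EllTwo G) (delta 0) (-g) *
      (y : EllTwo G →L[ℂ] EllTwo G) (delta 0) g) (canonicalTrace β (x * y)) := by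
  have h1 : canonicalTrace β (x * y) = ⟪star (x : EllTwo G →L[ℂ] EllTwo G) (delta 0),
      (y : EllTwo G →L[ℂ] EllTwo G) (delta 0)⟫_ℂ := by
    rw [ContinuousLinearMap.star_eq_adjoint, ContinuousLinearMap.adjoint_inner_left]
    rfl
  rw [h1]
  refine (lp.hasSum_inner _ _).congr_fun ?_
  intro g
  have h2 : star (x : EllTwo G →L[ℂ] EllTwo G) (delta 0) g =
      (starRingEnd ℂ) (β.toFun (-g) g * (x : EllTwo G →L[ℂ] EllTwo G) (delta 0) (-g)) := by
    rw [← inner_delta g, ContinuousLinearMap.star_eq_adjoint,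
      ContinuousLinearMap.adjoint_inner_right, ← inner_conj_symm, inner_delta,
      apply_delta_of_mem x.2, rightTranslation_apply, zero_sub]
  rw [h2, RCLike.inner_apply, RCLike.conj_conj, mul_comm]

variable (β) in
theorem isFaithfulNormalTracialState_canonicalTrace :
    IsFaithfulNormalTracialState (twistedGroupVN β) (canonicalTrace β) where
  map_one := by
    change ⟪delta 0, (1 : EllTwo G →L[ℂ] EllTwo G) (delta 0)⟫_ℂ = 1
    rw [inner_delta]
    exact delta_self 0
  nonneg x hx := (ContinuousLinearMap.nonneg_iff_isPositive _).1 hx |>.inner_nonneg_right _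
  tracial x y := by
    have h1 := hasSum_canonicalTrace_mul x y
    rw [← (Equiv.neg G).hasSum_iff] at h1
    refine h1.unique ((hasSum_canonicalTrace_mul y x).congr_fun fun g => ?_)
    simp only [Function.comp_apply, Equiv.neg_apply, neg_neg]
    rw [β.neg_left_eq_neg_right]
    ring
  faithful x hx := by
    rw [canonicalTrace_star_mul_self] at hx
    have h1 : ‖(x : EllTwo G →L[ℂ] EllTwo G) (delta 0)‖ = 0 := by
      have : ‖(x : EllTwo G →L[ℂ] EllTwo G) (delta 0)‖ ^ 2 = 0 := by exact_mod_cast hx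
      exact pow_eq_zero_iff two_ne_zero |>.1 this
    refine Subtype.ext (eq_of_apply_delta_zero x.2 (zero_mem (twistedGroupVN β)) ?_)
    rw [norm_eq_zero.1 h1]
    rfl
  normal := by
    refine ⟨fun k => if k = 0 then delta 0 else 0, fun k => if k = 0 then delta 0 else 0, ?_, ?_,
      fun x => ?_⟩
    · exact summable_of_ne_finset_zero (s := {0}) fun k hk => by
        simp [Finset.notMem_singleton.1 hk]
    · exact summable_of_ne_finset_zero (s := {0}) fun k hk => by
        simp [Finset.notMem_singleton.1 hk]
    · exact hasSum_single 0 fun k hk => by simp [hk]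

instance [Finite G] : FiniteDimensional ℂ (twistedGroupVN β).toStarSubalgebra :=
  FiniteDimensional.finiteDimensional_submodule
    (Subalgebra.toSubmodule (twistedGroupVN β).toStarSubalgebra.toSubalgebra)

variable (β) in
/-- The span of the left translations by a subgroup. -/
def translationSpan (F : AddSubgroup G) : StarSubalgebra ℂ (EllTwo G →L[ℂ] EllTwo G) where
  carrier := Submodule.span ℂ (leftTranslation β '' F)
  mul_mem' := by
    intro x y hx hy
    induction hx, hy using Submodule.span_induction₂ with
    | mem_mem x y hx hy =>
      obtain ⟨g, hg, rfl⟩ := hx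
      obtain ⟨h, hh, rfl⟩ := hy
      rw [leftTranslation_mul]
      exact Submodule.smul_mem _ _ (Submodule.subset_span ⟨_, F.add_mem hg hh, rfl⟩)
    | zero_left => rw [zero_mul]; exact Submodule.zero_mem _
    | zero_right => rw [mul_zero]; exact Submodule.zero_mem _
    | add_left x y z _ _ _ h1 h2 => rw [add_mul]; exact Submodule.add_mem _ h1 h2
    | add_right x y z _ _ _ h1 h2 => rw [mul_add]; exact Submodule.add_mem _ h1 h2
    | smul_left r x y _ _ h => rw [smul_mul_assoc]; exact Submodule.smul_mem _ _ h
    | smul_right r x y _ _ h => rw [mul_smul_comm]; exact Submodule.smul_mem _ _ h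
  add_mem' := Submodule.add_mem _
  algebraMap_mem' z := by
    rw [Algebra.algebraMap_eq_smul_one, ← leftTranslation_zero β]
    exact Submodule.smul_mem _ _ (Submodule.subset_span ⟨0, F.zero_mem, rfl⟩)
  star_mem' := by
    intro x hx
    induction hx using Submodule.span_induction with
    | mem x hx =>
      obtain ⟨g, hg, rfl⟩ := hx
      rw [star_leftTranslation]
      exact Submodule.smul_mem _ _ (Submodule.subset_span ⟨_, F.neg_mem hg, rfl⟩)
    | zero => rw [star_zero]; exact Submodule.zero_mem _
    | add x y _ _ hx hy => rw [star_add]; exact Submodule.add_mem _ hx hy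
    | smul r x _ hx => rw [star_smul]; exact Submodule.smul_mem _ _ hx

theorem coe_translationSpan (F : AddSubgroup G) :
    (translationSpan β F : Set (EllTwo G →L[ℂ] EllTwo G)) =
      Submodule.span ℂ (leftTranslation β '' F) := rfl

theorem isHyperfiniteIIOneFactor_twistedGroupVN [Infinite G]
    (hβ : ∀ h, (∀ g, β.toFun g h = β.toFun h g) → h = 0)
    (F : ℕ → AddSubgroup G) (hF : Monotone F) (hfin : ∀ k, (F k : Set G).Finite)
    (hcov : ∀ g, ∃ k, g ∈ F k) :
    IsHyperfiniteIIOneFactor (twistedGroupVN β) (canonicalTrace β) where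
  trace := isFaithfulNormalTracialState_canonicalTrace β
  -- For central `x`, left and right translates of `x δ₀` agree, so `β(g, h)` and `β(h, g)` coincide
  -- for all `g` wherever the coefficient at `h` is nonzero. Nondegeneracy leaves only `h = 0`.
  factor x hx hx' := by
    have h1 : ∀ g, leftTranslation β g (x (delta 0)) = rightTranslation β g (x (delta 0)) := by
      intro g
      rw [← apply_delta_of_mem hx, ← add_zero g, ← one_smul ℂ (delta (g + 0)), ← β.zero_right g,
        ← leftTranslation_delta, add_zero]
      exact congrArg (fun y : EllTwo G →L[ℂ] EllTwo G => y (delta 0))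
        (VonNeumannAlgebra.mem_commutant_iff.1 hx' _ (leftTranslation_mem β g))
    have h2 : ∀ h, h ≠ 0 → x (delta 0) h = 0 := by
      intro h hh
      by_contra hne
      refine hh (hβ h fun g => ?_)
      have h3 := congrArg (fun f : EllTwo G => f (h + g)) (h1 g)
      simp only [leftTranslation_apply, rightTranslation_apply, add_sub_cancel_right] at h3
      exact mul_right_cancel₀ hne h3
    refine ⟨x (delta 0) 0, eq_of_apply_delta_zero hx
      ((twistedGroupVN β).toStarSubalgebra.smul_mem (one_mem _) _) ?_⟩
    ext h
    change _ = x (delta 0) 0 * delta 0 h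
    by_cases hh : h = 0
    · rw [hh, delta_self, mul_one]
    · rw [h2 h hh, delta_of_ne hh, mul_zero]
  infinite hfd := by
    let L : (twistedGroupVN β).toStarSubalgebra →ₗ[ℂ] EllTwo G :=
      { toFun := fun x => (x : EllTwo G →L[ℂ] EllTwo G) (delta 0)
        map_add' := fun _ _ => rfl
        map_smul' := fun _ _ => rfl }
    let v : G → (twistedGroupVN β).toStarSubalgebra := fun g =>
      ⟨leftTranslation β g, leftTranslation_mem β g⟩
    have hv : L ∘ v = delta := by
      ext1 g
      change leftTranslation β g (delta 0) = delta g
      rw [leftTranslation_delta, β.zero_right, one_smul, add_zero]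
    have h1 : LinearIndependent ℂ v := LinearIndependent.of_comp L (by
      rw [hv]; exact linearIndependent_delta)
    exact not_finite_iff_infinite.2 ‹Infinite G› h1.finite
  hyperfinite := by
    refine ⟨fun k => translationSpan β (F k), fun j k hjk => ?_, fun k => ?_, ?_⟩
    · exact Submodule.span_mono (Set.image_mono (hF hjk))
    · exact FiniteDimensional.span_of_finite ℂ ((hfin k).image _)
    · rw [coe_twistedGroupVN]
      congr 1
      refine Set.Subset.antisymm (Set.centralizer_subset ?_) ?_
      · rintro _ ⟨g, rfl⟩
        obtain ⟨k, hk⟩ := hcov g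
        exact Set.mem_iUnion.2 ⟨k, Submodule.subset_span ⟨g, hk, rfl⟩⟩
      · intro y hy x hx
        obtain ⟨k, hk⟩ := Set.mem_iUnion.1 hx
        rw [coe_translationSpan] at hk
        clear hx
        induction hk using Submodule.span_induction with
        | mem x hx => obtain ⟨g, -, rfl⟩ := hx; exact hy _ ⟨g, rfl⟩
        | zero => rw [zero_mul, mul_zero]
        | add x z _ _ hx hz => rw [add_mul, mul_add, hx, hz]
        | smul c x _ hx => rw [smul_mul_assoc, mul_smul_comm, hx]

/-- A hyperfinite II₁ factor embeds into its own ultrapower as the constant sequences. -/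
theorem embedsInUltrapower_twistedGroupVN
    (hR : IsHyperfiniteIIOneFactor (twistedGroupVN β) (canonicalTrace β)) :
    EmbedsInUltrapower (twistedGroupVN β) (canonicalTrace β) := by
  let const : (twistedGroupVN β).toStarSubalgebra → boundedSeq (twistedGroupVN β) := fun x =>
    ⟨fun _ => x, ‖(x : EllTwo G →L[ℂ] EllTwo G)‖, fun _ => le_rfl⟩
  let φ : (twistedGroupVN β).toStarSubalgebra →⋆ₐ[ℂ] Ultrapower hR.trace (hyperfilter ℕ) :=
    { toFun := fun x => Ultrapower.mk hR.trace (hyperfilter ℕ) (const x)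
      map_one' := rfl
      map_mul' := fun _ _ => rfl
      map_zero' := rfl
      map_add' := fun _ _ => rfl
      commutes' := fun _ => rfl
      map_star' := fun _ => rfl }
  -- The 2-norm of the trace is the norm of the image of `δ₀`. This gives injectivity for constant
  -- sequences, and the trace clause by Cauchy–Schwarz.
  have hmk : ∀ (y z : boundedSeq (twistedGroupVN β)),
      Ultrapower.mk hR.trace (hyperfilter ℕ) y = Ultrapower.mk hR.trace (hyperfilter ℕ) z →
        Tendsto (fun k => ‖(y.1 k - z.1 k : EllTwo G →L[ℂ] EllTwo G) (delta 0)‖)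
          (hyperfilter ℕ) (𝓝 0) := by
    intro y z hyz
    have h1 := (TwoSidedIdeal.rel_iff _ _ _).1 (Quotient.exact hyz)
    rw [mem_nullIdeal] at h1
    have h2 : Tendsto
        (fun k => ((‖(y.1 k - z.1 k : EllTwo G →L[ℂ] EllTwo G) (delta 0)‖ ^ 2 : ℝ) : ℂ))
        (hyperfilter ℕ) (𝓝 0) := by
      refine h1.congr fun k => ?_
      exact canonicalTrace_star_mul_self _
    have h3 := (Complex.continuous_re.tendsto _).comp h2
    have h4 := h3.sqrt
    simp only [Complex.zero_re, Real.sqrt_zero] at h4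
    refine h4.congr fun k => ?_
    simp only [Function.comp_apply, Complex.ofReal_re]
    exact Real.sqrt_sq (norm_nonneg _)
  refine ⟨EllTwo G, inferInstance, inferInstance, inferInstance, twistedGroupVN β,
    canonicalTrace β, hR, hyperfilter ℕ, hyperfilter_le_cofinite, φ, ?_, ?_⟩
  · intro x y hxy
    have h1 : Tendsto (fun _ : ℕ => ‖(x - y : EllTwo G →L[ℂ] EllTwo G) (delta 0)‖)
        (hyperfilter ℕ) (𝓝 0) := hmk (const x) (const y) hxy
    have h2 := tendsto_nhds_unique tendsto_const_nhds h1
    refine Subtype.ext (eq_of_apply_delta_zero x.2 y.2 ?_)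
    exact sub_eq_zero.1 (norm_eq_zero.1 h2)
  · intro x y hxy
    have h1 := hmk y (const x) hxy
    rw [tendsto_iff_norm_sub_tendsto_zero]
    refine squeeze_zero (fun _ => norm_nonneg _) (fun k => ?_) h1
    rw [← map_sub, canonicalTrace_apply]
    refine (norm_inner_le_norm _ _).trans ?_
    rw [norm_delta, one_mul]
    rfl

end Twisted

/-! ### Heisenberg families -/

section Heisenberg

/-- Unitaries of `N` that represent the Heisenberg group of `ℤ/d` projectively. -/
structure IsHeisenbergFamily {H : Type*} [NormedAddCommGroup H] [InnerProductSpace ℂ H]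
    [CompleteSpace H] (N : VonNeumannAlgebra H) (d : ℕ) [NeZero d]
    (w : ZMod d × ZMod d → H →L[ℂ] H) : Prop where
  mem : ∀ g, w g ∈ N
  zero : w 0 = 1
  mul : ∀ g h, w g * w h = (ZMod.stdAddChar (g.2 * h.1) : ℂ) • w (g + h)
  star : ∀ g, star (w g) = (ZMod.stdAddChar (g.2 * g.1) : ℂ) • w (-g)

theorem IsHeisenbergFamily.mul_star {H : Type*} [NormedAddCommGroup H] [InnerProductSpace ℂ H]
    [CompleteSpace H] {N : VonNeumannAlgebra H} {d : ℕ} [NeZero d]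
    {w : ZMod d × ZMod d → H →L[ℂ] H} (hw : IsHeisenbergFamily N d w) (g : ZMod d × ZMod d) :
    w g * Star.star (w g) = 1 := by
  rw [hw.star, mul_smul_comm, hw.mul, smul_smul, ← AddChar.map_add_eq_mul, add_neg_cancel,
    hw.zero, Prod.fst_neg, mul_neg, add_neg_cancel, AddChar.map_zero_eq_one, one_smul]

/-! ### Twisted group algebras that contain Heisenberg families. -/

variable {ι : Type} [DecidableEq ι] (m : ι → ℕ) [∀ i, NeZero (m i)]

/-- The direct sum of the groups `(ℤ/mᵢ)²`. -/
abbrev PhaseGroup : Type := Π₀ i, ZMod (m i) × ZMod (m i)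

/-- The bicharacter of `⨁ (ℤ/mᵢ)²` whose twisted group algebra is the tensor product of the full
matrix algebras of size `mᵢ`. -/
def phaseBicharacter : Bicharacter (PhaseGroup m) where
  toFun g h := g.prod fun i x => (ZMod.stdAddChar (x.2 * (h i).1) : ℂ)
  add_left g h k := DFinsupp.prod_add_index (fun i => by simp)
    (fun i x y => by rw [Prod.snd_add, add_mul, AddChar.map_add_eq_mul])
  add_right g h k := by
    rw [← DFinsupp.prod_mul]
    congr 1
    ext i x
    rw [DFinsupp.add_apply, Prod.fst_add, mul_add, AddChar.map_add_eq_mul]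
  norm_eq_one g h := by
    rw [DFinsupp.prod, norm_prod]
    exact Finset.prod_eq_one fun i _ => by rw [ZMod.stdAddChar_apply, Circle.norm_coe]

theorem phaseBicharacter_apply (g h : PhaseGroup m) : (phaseBicharacter m).toFun g h =
    g.prod fun i x => (ZMod.stdAddChar (x.2 * (h i).1) : ℂ) := rfl

theorem phaseBicharacter_single_left (i : ι) (x : ZMod (m i) × ZMod (m i)) (h : PhaseGroup m) :
    (phaseBicharacter m).toFun (DFinsupp.single i x) h = ZMod.stdAddChar (x.2 * (h i).1) := by
  rw [phaseBicharacter_apply]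
  exact DFinsupp.prod_single_index (by simp)

theorem phaseBicharacter_single_right (h : PhaseGroup m) (i : ι) (x : ZMod (m i) × ZMod (m i)) :
    (phaseBicharacter m).toFun h (DFinsupp.single i x) = ZMod.stdAddChar ((h i).2 * x.1) := by
  rw [phaseBicharacter_apply, DFinsupp.prod, Finset.prod_eq_single i]
  · rw [DFinsupp.single_eq_same]
  · intro j _ hj
    rw [DFinsupp.single_eq_of_ne hj, Prod.fst_zero, mul_zero, AddChar.map_zero_eq_one]
  · intro hi
    rw [DFinsupp.notMem_support_iff.1 hi, Prod.snd_zero, zero_mul, AddChar.map_zero_eq_one]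

/-- Testing against the two generators at `i` isolates the two coordinates of `h i`, and the
standard character is injective. -/
theorem phaseBicharacter_nondegenerate (h : PhaseGroup m)
    (hh : ∀ g, (phaseBicharacter m).toFun g h = (phaseBicharacter m).toFun h g) : h = 0 := by
  ext1 i
  have h1 := hh (DFinsupp.single i (0, 1))
  have h2 := hh (DFinsupp.single i (1, 0))
  rw [phaseBicharacter_single_left, phaseBicharacter_single_right] at h1 h2
  simp only [one_mul, mul_zero, zero_mul, mul_one] at h1 h2
  exact Prod.ext (ZMod.injective_stdAddChar h1) (ZMod.injective_stdAddChar h2).symm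

theorem isHeisenbergFamily_leftTranslation (i : ι) :
    IsHeisenbergFamily (twistedGroupVN (phaseBicharacter m)) (m i)
      (fun x => leftTranslation (phaseBicharacter m) (DFinsupp.single i x)) where
  mem _ := leftTranslation_mem _ _
  zero := by rw [DFinsupp.single_zero, leftTranslation_zero]
  mul g h := by
    rw [leftTranslation_mul, phaseBicharacter_single_left, DFinsupp.single_eq_same,
      DFinsupp.single_add]
  star g := by
    rw [star_leftTranslation, phaseBicharacter_single_left, DFinsupp.single_eq_same,
      DFinsupp.single_neg]

theorem infinite_phaseGroup : Infinite (PhaseGroup fun i : ℕ => i + 1) := by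
  -- The index is shifted because the summand at `0` is trivial.
  refine Infinite.of_injective (fun i : ℕ => (DFinsupp.single (i + 1) (1, 0) :
    PhaseGroup fun i : ℕ => i + 1)) fun i j hij => ?_
  by_contra hne
  have h1 := congrArg (fun g : PhaseGroup (fun i : ℕ => i + 1) => (g (i + 1)).1) hij
  simp only [DFinsupp.single_eq_same] at h1
  rw [DFinsupp.single_eq_of_ne (by omega)] at h1
  have : Fact (1 < i + 1 + 1) := ⟨by omega⟩
  exact one_ne_zero h1

theorem isHyperfiniteIIOneFactor_phaseGroup :
    IsHyperfiniteIIOneFactor (twistedGroupVN (phaseBicharacter fun i : ℕ => i + 1))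
      (canonicalTrace (phaseBicharacter fun i : ℕ => i + 1)) := by
  have := infinite_phaseGroup
  let F : ℕ → AddSubgroup (PhaseGroup fun i : ℕ => i + 1) := fun k =>
    { carrier := {g | ∀ i, k ≤ i → g i = 0}
      add_mem' := fun {a b} ha hb i hi => by rw [DFinsupp.add_apply, ha i hi, hb i hi, add_zero]
      zero_mem' := fun _ _ => rfl
      neg_mem' := fun {a} ha i hi => by rw [DFinsupp.neg_apply, ha i hi, neg_zero] }
  refine isHyperfiniteIIOneFactor_twistedGroupVN (phaseBicharacter_nondegenerate _) F
    (fun j k hjk g hg i hi => hg i (hjk.trans hi)) (fun k => ?_) (fun g => ?_)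
  · have hfin : Finite (F k) := by
      refine Finite.of_injective (β := ∀ i : Fin k, ZMod (i + 1) × ZMod (i + 1))
        (fun (g : F k) (i : Fin k) => g.1 i) fun g h hgh => ?_
      refine Subtype.ext (DFinsupp.ext fun i => ?_)
      by_cases hi : i < k
      · exact congrFun hgh ⟨i, hi⟩
      · rw [g.2 i (not_lt.1 hi), h.2 i (not_lt.1 hi)]
    exact Set.toFinite _
  · refine ⟨g.support.sup id + 1, fun i hi => ?_⟩
    by_contra hne
    have := Finset.le_sup (f := id) (DFinsupp.mem_support_iff.2 hne)
    simp only [id] at this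
    omega

end Heisenberg

/-! ### Optimal colorings -/

section Coloring

variable {n : ℕ} {M : StarSubalgebra ℂ (Matrix (Fin n) (Fin n) ℂ)} {κ : Type} [Fintype κ]
  {d : κ → ℕ} [∀ k, NeZero (d k)]

namespace MatrixUnits

variable (E : MatrixUnits M κ d)

/-- The Weyl unitaries of a block. -/
def weyl (k : κ) (g : ZMod (d k) × ZMod (d k)) : Matrix (Fin n) (Fin n) ℂ :=
  ∑ j, (ZMod.stdAddChar (g.1 * j) : ℂ) • E.e k j (j - g.2)

theorem weyl_mem (k : κ) (g : ZMod (d k) × ZMod (d k)) : E.weyl k g ∈ M :=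
  sum_mem fun _ _ => M.smul_mem (E.mem _ _ _) _

theorem weyl_zero (k : κ) : E.weyl k 0 = E.blockProj k := by
  simp [weyl, blockProj]

/-- The phase is the inverse of the one in `IsHeisenbergFamily`, so the two cancel in a tensor
product. -/
theorem weyl_mul (k : κ) (g h : ZMod (d k) × ZMod (d k)) :
    E.weyl k g * E.weyl k h = (ZMod.stdAddChar (-(g.2 * h.1)) : ℂ) • E.weyl k (g + h) := by
  simp only [weyl, Finset.sum_mul, Finset.mul_sum, Finset.smul_sum]
  rw [Finset.sum_comm]
  refine Finset.sum_congr rfl fun j _ => ?_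
  rw [Finset.sum_eq_single (j - g.2)]
  · rw [smul_mul_smul_comm, E.mul_e, smul_smul, ← AddChar.map_add_eq_mul, ← AddChar.map_add_eq_mul,
      Prod.fst_add, Prod.snd_add, sub_sub]
    congr 2
    ring
  · intro l _ hl
    rw [smul_mul_smul_comm, E.mul_of_ne _ _ _ _ _ (Ne.symm hl), smul_zero]
  · simp

theorem weyl_mul_of_ne {k k' : κ} (hk : k ≠ k') (g : ZMod (d k) × ZMod (d k))
    (h : ZMod (d k') × ZMod (d k')) : E.weyl k g * E.weyl k' h = 0 := by
  simp only [weyl, Finset.sum_mul, Finset.mul_sum]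
  refine Finset.sum_eq_zero fun i _ => Finset.sum_eq_zero fun j _ => ?_
  rw [smul_mul_smul_comm, E.mul_of_block_ne _ _ _ _ _ _ hk, smul_zero]

theorem star_weyl (k : κ) (g : ZMod (d k) × ZMod (d k)) :
    star (E.weyl k g) = (ZMod.stdAddChar (-(g.2 * g.1)) : ℂ) • E.weyl k (-g) := by
  simp only [weyl, star_sum, Finset.smul_sum]
  refine Fintype.sum_equiv (Equiv.subRight g.2) _ _ fun j => ?_
  rw [star_smul, E.star_e, Equiv.subRight_apply, smul_smul, ← AddChar.map_add_eq_mul,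
    Prod.snd_neg, Prod.fst_neg, sub_neg_eq_add, sub_add_cancel]
  congr 1
  rw [RCLike.star_def, ← AddChar.map_neg_eq_conj]
  congr 1
  ring

/-- Summing over the phase coordinate forces equal outer indices and gives a factor `d k`; the shift
coordinate then runs through the inner index. -/
theorem sum_weyl_conj (k : κ) (X : Matrix (Fin n) (Fin n) ℂ) :
    ∑ g, E.weyl k g * X * star (E.weyl k g) = (d k : ℂ) • E.average k X := by
  have h1 : ∀ a b, E.weyl k (a, b) * X * star (E.weyl k (a, b)) = ∑ j, ∑ l,
      (ZMod.stdAddChar (a * (j - l)) : ℂ) • (E.e k j (j - b) * X * E.e k (l - b) l) := by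
    intro a b
    simp only [weyl, star_sum, Finset.sum_mul, Finset.mul_sum]
    rw [Finset.sum_comm]
    refine Finset.sum_congr rfl fun j _ => Finset.sum_congr rfl fun l _ => ?_
    rw [star_smul, E.star_e, smul_mul_assoc, smul_mul_smul_comm, mul_sub, sub_eq_add_neg (a * j),
      AddChar.map_add_eq_mul, AddChar.map_neg_eq_conj]
    rfl
  have hd : Fintype.card (ZMod (d k)) = d k := ZMod.card _
  rw [Fintype.sum_prod_type, Finset.sum_comm]
  simp only [h1]
  have h2 : ∀ b, ∑ a : ZMod (d k), ∑ j, ∑ l,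
      (ZMod.stdAddChar (a * (j - l)) : ℂ) • (E.e k j (j - b) * X * E.e k (l - b) l) =
      ∑ j, (d k : ℂ) • (E.e k j (j - b) * X * E.e k (j - b) j) := by
    intro b
    rw [Finset.sum_comm]
    refine Finset.sum_congr rfl fun j _ => ?_
    rw [Finset.sum_comm, Finset.sum_eq_single j]
    · rw [← Finset.sum_smul, AddChar.sum_mulShift _ (ZMod.isPrimitive_stdAddChar _),
        if_pos (sub_self j), hd]
    · intro l _ hl
      rw [← Finset.sum_smul, AddChar.sum_mulShift _ (ZMod.isPrimitive_stdAddChar _),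
        if_neg (sub_ne_zero.2 (Ne.symm hl)), Nat.cast_zero, zero_smul]
    · simp
  simp only [h2, average, Finset.smul_sum]
  rw [Finset.sum_comm]
  refine Finset.sum_congr rfl fun j _ => ?_
  exact Fintype.sum_equiv (Equiv.subLeft j) _ _ fun b => rfl

end MatrixUnits

/-! ### The upper bound: spectral projections of Weyl–Heisenberg tensors. -/

variable {H : Type*} [NormedAddCommGroup H] [InnerProductSpace ℂ H]

theorem tmul_smul_smul (a b : ℂ) (x : Matrix (Fin n) (Fin n) ℂ) (y : H →L[ℂ] H) :
    tmul (a • x) (b • y) = (a * b) • tmul x y := by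
  ext1 i j
  simp only [tmul, Matrix.smul_apply, Matrix.of_apply, smul_eq_mul, smul_smul]
  congr 1
  ring

variable (E : MatrixUnits M κ d)

/-- The representation of the phase space group of a block given by products of Weyl unitaries with
Heisenberg unitaries of the conjugate cocycle. -/
def weylTensor (w : ∀ k, ZMod (d k) × ZMod (d k) → H →L[ℂ] H) (k : κ)
    (g : ZMod (d k) × ZMod (d k)) : Matrix (Fin n) (Fin n) (H →L[ℂ] H) :=
  tmul (E.weyl k g) (w k g)

theorem weylTensor_mul_of_ne {w : ∀ k, ZMod (d k) × ZMod (d k) → H →L[ℂ] H} {k k' : κ} (hk : k ≠ k')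
    (g : ZMod (d k) × ZMod (d k)) (h : ZMod (d k') × ZMod (d k')) :
    weylTensor E w k g * weylTensor E w k' h = 0 := by
  rw [weylTensor, weylTensor, tmul_mul_tmul, E.weyl_mul_of_ne hk]
  exact (tmulLinear _).map_zero

variable [CompleteSpace H] {N : VonNeumannAlgebra H}
  {w : ∀ k, ZMod (d k) × ZMod (d k) → H →L[ℂ] H}

theorem weylTensor_mul (hw : ∀ k, IsHeisenbergFamily N (d k) (w k)) (k : κ)
    (g h : ZMod (d k) × ZMod (d k)) :
    weylTensor E w k g * weylTensor E w k h = weylTensor E w k (g + h) := by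
  rw [weylTensor, weylTensor, tmul_mul_tmul, E.weyl_mul, (hw k).mul, tmul_smul_smul,
    ← AddChar.map_add_eq_mul, neg_add_cancel, AddChar.map_zero_eq_one, one_smul, weylTensor]

theorem star_weylTensor (hw : ∀ k, IsHeisenbergFamily N (d k) (w k)) (k : κ)
    (g : ZMod (d k) × ZMod (d k)) : star (weylTensor E w k g) = weylTensor E w k (-g) := by
  rw [weylTensor, star_tmul, E.star_weyl, (hw k).star, tmul_smul_smul,
    ← AddChar.map_add_eq_mul, neg_add_cancel, AddChar.map_zero_eq_one, one_smul, weylTensor]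

theorem sum_weylTensor_conj (hw : ∀ k, IsHeisenbergFamily N (d k) (w k)) (k : κ)
    {X : Matrix (Fin n) (Fin n) ℂ}
    (hX : X ∈ tracePerp (Set.centralizer (M : Set (Matrix (Fin n) (Fin n) ℂ)))) :
    ∑ g, weylTensor E w k g * tmul X 1 * star (weylTensor E w k g) = 0 := by
  have h1 : ∀ g, weylTensor E w k g * tmul X 1 * star (weylTensor E w k g) =
      tmulLinear 1 (E.weyl k g * X * star (E.weyl k g)) := fun g => by
    rw [weylTensor, star_tmul, tmul_mul_tmul, tmul_mul_tmul, mul_one, (hw k).mul_star]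
    rfl
  simp only [h1]
  rw [← map_sum, E.sum_weyl_conj, E.average_eq_zero hX, smul_zero, map_zero]

/-- The projection absorbs `z g` on one side and `star (z g)` on the other with inverse phases, so
its compression of `X` equals that of every conjugate of `X`. The conjugates sum to zero. -/
theorem charProj_mul_tmul_mul_charProj (hw : ∀ k, IsHeisenbergFamily N (d k) (w k)) (k : κ)
    (ψ : AddChar (ZMod (d k) × ZMod (d k)) ℂ) {X : Matrix (Fin n) (Fin n) ℂ}
    (hX : X ∈ tracePerp (Set.centralizer (M : Set (Matrix (Fin n) (Fin n) ℂ)))) :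
    charProj (weylTensor E w k) ψ * tmul X 1 * charProj (weylTensor E w k) ψ = 0 := by
  set p := charProj (weylTensor E w k) ψ with hp
  have hz := weylTensor_mul E hw k
  have h1 : ∀ g, p * (weylTensor E w k g * tmul X 1 * star (weylTensor E w k g)) * p =
      p * tmul X 1 * p := by
    intro g
    have e1 : p * (weylTensor E w k g * tmul X 1 * star (weylTensor E w k g)) * p =
        (p * weylTensor E w k g) * tmul X 1 * (star (weylTensor E w k g) * p) := by
      simp only [mul_assoc]
    rw [e1, star_weylTensor E hw, hp, charProj_mul hz, mul_charProj hz, neg_neg, smul_mul_assoc,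
      smul_mul_smul_comm, ← AddChar.map_add_eq_mul, neg_add_cancel, AddChar.map_zero_eq_one,
      one_smul]
  have h2 : ∑ g : ZMod (d k) × ZMod (d k),
      p * (weylTensor E w k g * tmul X 1 * star (weylTensor E w k g)) * p = 0 := by
    rw [← Finset.sum_mul, ← Finset.mul_sum, sum_weylTensor_conj E hw k hX, mul_zero, zero_mul]
  simp only [h1] at h2
  rw [Finset.sum_const, Finset.card_univ, ← Nat.cast_smul_eq_nsmul ℂ] at h2
  exact (smul_eq_zero_iff_right (by exact_mod_cast Fintype.card_ne_zero)).1 h2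

theorem charProj_mem_vnTensor (hw : ∀ k, IsHeisenbergFamily N (d k) (w k)) (k : κ)
    (ψ : AddChar (ZMod (d k) × ZMod (d k)) ℂ) :
    charProj (weylTensor E w k) ψ ∈ vnTensor M N := by
  intro y hy
  rw [charProj, mul_smul_comm, smul_mul_assoc, Finset.mul_sum, Finset.sum_mul]
  congr 1
  refine Finset.sum_congr rfl fun g _ => ?_
  rw [mul_smul_comm, smul_mul_assoc]
  congr 1
  exact tmul_mem_vnTensor (E.weyl_mem k g) ((hw k).mem g) y hy

theorem exists_isBFoldColoring
    (hM : Set.centralizer (Set.centralizer (M : Set (Matrix (Fin n) (Fin n) ℂ))) = M)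
    (E : MatrixUnits M κ d) (N : VonNeumannAlgebra H)
    (hN : ∀ k, ∃ w, IsHeisenbergFamily N (d k) w) (b : ℕ) :
    ∃ P : Fin (b * Module.finrank ℂ M) → Matrix (Fin n) (Fin n) (H →L[ℂ] H),
      IsBFoldColoring (completeQuantumGraph M hM) N b P := by
  classical
  choose w hw using hN
  -- One projection per block and character: a group of order `d k ^ 2` has as many characters,
  -- which makes `dim M` in all.
  let C : Type := Σ k, AddChar (ZMod (d k) × ZMod (d k)) ℂ
  let R : C → Matrix (Fin n) (Fin n) (H →L[ℂ] H) := fun x => charProj (weylTensor E w x.1) x.2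
  have hR : ∀ x, R x * R x = R x := fun x => by
    have := charProj_mul_charProj (weylTensor_mul E hw x.1) x.2 x.2
    rwa [if_pos rfl] at this
  have hR' : ∀ x y, x ≠ y → R x * R y = 0 := by
    rintro ⟨k, ψ⟩ ⟨l, φ⟩ hxy
    by_cases hk : k = l
    · subst hk
      have := charProj_mul_charProj (weylTensor_mul E hw k) ψ φ
      rwa [if_neg (fun h => hxy (by rw [h]))] at this
    · change charProj _ ψ * charProj _ φ = 0
      rw [charProj, charProj, smul_mul_smul_comm, Finset.sum_mul_sum]
      rw [Finset.sum_eq_zero, smul_zero]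
      intro g _
      refine Finset.sum_eq_zero fun h _ => ?_
      rw [smul_mul_smul_comm, weylTensor_mul_of_ne E hk, smul_zero]
  have hsum : ∑ x, R x = 1 := by
    rw [Fintype.sum_sigma, ← tmul_one_one, ← E.sum_blockProj]
    change _ = tmulLinear 1 _
    rw [map_sum]
    refine Finset.sum_congr rfl fun k _ => ?_
    refine (sum_charProj (weylTensor E w k)).trans ?_
    rw [weylTensor, E.weyl_zero, (hw k).zero]
    rfl
  have hcomm : ∀ x y, Commute (R x) (R y) := by
    intro x y
    by_cases hxy : x = y
    · rw [hxy]
    · rw [Commute, SemiconjBy, hR' x y hxy, hR' y x (Ne.symm hxy)]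
  have hcard : Fintype.card (Fin b × C) = b * Module.finrank ℂ M := by
    rw [Fintype.card_prod, Fintype.card_fin, Fintype.card_sigma, E.finrank_eq]
    congr 1
    refine Finset.sum_congr rfl fun k _ => ?_
    rw [AddChar.card_eq, Fintype.card_prod, ZMod.card, sq]
  let e : Fin (b * Module.finrank ℂ M) ≃ Fin b × C :=
    Fintype.equivOfCardEq (by rw [Fintype.card_fin, hcard])
  have hfib : ∀ x, (Finset.univ.filter fun a => (e a).2 = x).card = b := by
    intro x
    have : (Finset.univ.filter fun a => (e a).2 = x).map e.toEmbedding =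
        Finset.univ ×ˢ {x} := by
      ext ⟨i, y⟩
      simp only [Finset.mem_map, Finset.mem_filter, Finset.mem_univ, true_and,
        Equiv.coe_toEmbedding, Finset.mem_product, Finset.mem_singleton]
      constructor
      · rintro ⟨a, ha, hay⟩
        rw [← ha, hay]
      · intro hy
        exact ⟨e.symm (i, y), by rw [e.apply_symm_apply, hy], e.apply_symm_apply _⟩
    rw [← Finset.card_map e.toEmbedding, this]
    simp
  refine ⟨fun a => R (e a).2, fun a => charProj_mem_vnTensor E hw _ _, fun a => ⟨hR _, ?_⟩,
    ⟨fun a a' => hcomm _ _, ?_⟩, fun a X hX => charProj_mul_tmul_mul_charProj E hw _ _ hX⟩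
  · exact star_charProj (star_weylTensor E hw _) _
  · exact sum_noncommProd_of_fibers hR hR' hsum (fun a => (e a).2) hfib fun _ _ => hcomm _ _

theorem hasBFoldColoring_completeQuantumGraph
    (hM : Set.centralizer (Set.centralizer (M : Set (Matrix (Fin n) (Fin n) ℂ))) = M) (b : ℕ)
    {t : ColoringType} (ht : t = .q ∨ t = .qa ∨ t = .qc) :
    HasBFoldColoring (completeQuantumGraph M hM) t b (b * Module.finrank ℂ M) := by
  obtain ⟨κ, _, _, d, _, ⟨E⟩⟩ := exists_matrixUnits hM
  have hfinite : ∀ t : ColoringType, t = .q ∨ t = .qc →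
      HasBFoldColoring (completeQuantumGraph M hM) t b (b * Module.finrank ℂ M) := by
    intro t ht
    refine ⟨EllTwo (PhaseGroup d), inferInstance, inferInstance, inferInstance, inferInstance,
      twistedGroupVN (phaseBicharacter d), canonicalTrace (phaseBicharacter d),
      isFaithfulNormalTracialState_canonicalTrace _, ?_, exists_isBFoldColoring hM E _
        (fun k => ⟨_, isHeisenbergFamily_leftTranslation d k⟩) b⟩
    rcases ht with rfl | rfl
    · have : Finite (PhaseGroup d) := inferInstance
      exact inferInstanceAs (FiniteDimensional ℂ
        (twistedGroupVN (phaseBicharacter d)).toStarSubalgebra)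
    · trivial
  rcases ht with rfl | rfl | rfl
  · exact hfinite _ (Or.inl rfl)
  · refine ⟨EllTwo (PhaseGroup fun i : ℕ => i + 1), inferInstance, inferInstance, inferInstance,
      inferInstance, twistedGroupVN (phaseBicharacter fun i : ℕ => i + 1),
      canonicalTrace (phaseBicharacter fun i : ℕ => i + 1),
      isFaithfulNormalTracialState_canonicalTrace _,
      embedsInUltrapower_twistedGroupVN isHyperfiniteIIOneFactor_phaseGroup,
      exists_isBFoldColoring hM E _ (fun k => ?_) b⟩
    -- Size `D` occurs as the summand at `D - 1`. A variable `D` replaces `d k` so that it can be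
    -- substituted.
    have h1 : ∀ (D : ℕ) [NeZero D], ∃ w, IsHeisenbergFamily
        (twistedGroupVN (phaseBicharacter fun i : ℕ => i + 1)) D w := by
      intro D hD
      obtain ⟨j, rfl⟩ := Nat.exists_eq_succ_of_ne_zero hD.out
      exact ⟨_, isHeisenbergFamily_leftTranslation (fun i : ℕ => i + 1) j⟩
    exact h1 (d k)
  · exact hfinite _ (Or.inr rfl)

/-- The lower bound compares norms with that of the identity, which is one only on a nonzero space.
-/
theorem nontrivial_of_isFaithfulNormalTracialState {τ : N.toStarSubalgebra →ₗ[ℂ] ℂ}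
    (hτ : IsFaithfulNormalTracialState N τ) : Nontrivial H := by
  by_contra h
  rw [not_nontrivial_iff_subsingleton] at h
  have h1 : (1 : N.toStarSubalgebra) = 0 :=
    Subtype.ext (ContinuousLinearMap.ext fun x => Subsingleton.elim _ _)
  have h2 := hτ.map_one
  rw [h1, map_zero] at h2
  exact zero_ne_one h2

end Coloring

end QGraph

end

theorem theorem3 (n : ℕ) (M : StarSubalgebra ℂ (Matrix (Fin n) (Fin n) ℂ))
    (hM : Set.centralizer (Set.centralizer (M : Set (Matrix (Fin n) (Fin n) ℂ))) = M)
    (b : ℕ) (t : QGraph.ColoringType)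
    (ht : t = QGraph.ColoringType.q ∨ t = QGraph.ColoringType.qa ∨ t = QGraph.ColoringType.qc) :
    QGraph.bFoldChromaticNumber (QGraph.completeQuantumGraph M hM) t b =
      ((b * Module.finrank ℂ M : ℕ) : ℕ∞) := by
  refine le_antisymm (sInf_le ⟨_, rfl, QGraph.hasBFoldColoring_completeQuantumGraph hM b ht⟩)
    (le_sInf ?_)
  rintro _ ⟨c, rfl, H, _, _, _, _, N, τ, hτ, -, P, hP⟩
  have := QGraph.nontrivial_of_isFaithfulNormalTracialState hτ
  exact_mod_cast QGraph.mul_finrank_le_of_isBFoldColoring hM N hP
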